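/- **Setting.** Let $N\in\mathbb N$, $1\le p<\infty$, let $B_j\subset\mathbb R^N$ be the closed ball of radius $j\in\mathbb N$ about $0$, and let $D\subset\mathbb R^N$ be countable and dense. Throughout, $I=[q_1,q_2]$ is an interval with $q_1\le q_2$ in $\mathbb Q$. $\mathfrak{LC}_p$ is the set of Borel functions $f:\mathbb R\times\mathbb R^N\to\mathbb R^N$ such that for every compact $K\subset\mathbb R^N$ there are $m^K,l^K\in L^p_{loc}$ with, for a.e. $t$, $|f(t,x)|\le m^K(t)$ and $|f(t,x)-f(t,y)|\le l^K(t)|x-y|$ for all $x,y\in K$. The topology $\mathcal T_D$ on $\mathfrak{LC}_p$ is generated by the seminorms $f\mapsto\big(\int_I|f(t,x)|^p\,dt\big)^{1/p}$, $x\in D$. A set $E\subset\mathfrak{LC}_p$ has $L^p_{loc}$-bounded $l$-bounds if for all $j\in\mathbb N$ and $r>0$ $$\sup_{f\in E}\int_{-r}^{r}\Big(\sup_{x\ne y\in B_j}\tfrac{|f(t,x)-f(t,y)|}{|x-y|}\Big)^p dt<\infty .$$ For $f\in\mathfrak{LC}_p$ and $x_0\in\mathbb R^N$, $x(\cdot,f,x_0)$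 denotes the maximal (Carathéodory) solution of $\dot x=f(t,x)$, $x(0)=x_0$, and $I_{f,x_0}$ its interval of definition. A suitable set of moduli of continuity is a family $\Theta=\{\theta^I_j\}_{I,\,j\in\mathbb N}$ of non-decreasing continuous functions $\theta^I_j:[0,\infty)\to[0,\infty)$ with $\theta^I_j(0)=0$ and $\theta^{I_1}_{j_1}\le\theta^{I_2}_{j_2}$ whenever $I_1\subseteq I_2$, $j_1\le j_2$. Let $\mathcal K^I_j$ be the set of continuous $x:I\to B_j$ with $|x(t)-x(s)|\le\theta^I_j(|t-s|)$ on $I$. For a finite-dimensional normed space $V$, $\Theta\mathfrak C_p(V)$ is the set of Borel functions $f:\mathbb R\times\mathbb R^N\to V$ that have, for every compact $K\subset\mathbb R^N$, an $m^K\in L^p_{loc}$ with $|f(t,x)|\le m^K(t)$ for a.e. $t$ and all $x\in K$, and that satisfy, for all $I,j$, $\int_I|f(t,x_n(t))-f(t,x(t))|^p\,dt\to0$ whenever $x_n\to x$ uniformly on $I$ with $x_n,x\in\mathcal K^I_j$. Its topology $\mathcal T_\Theta$ is generated by the seminorms $f\mapsto\sup_{x\in\mathcal K^I_j}\big(\int_I|f(t,x(t))|^p\,dt\big)^{1/p}$.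 For $C\subset\mathfrak{LC}_p$, let $C^I_j$ be the set of functions $x:J\to B_j$, with $J\subset I$ an interval, for which there is $f\in C$ such that $x(t)=x(s)+\int_s^tf(u,x(u))\,du$ for all $s,t\in J$. **Theorem.** Let $E\subset\mathfrak{LC}_p$ have $L^p_{loc}$-bounded $l$-bounds. (i) If $f_n\in E$, $f\in\mathfrak{LC}_p$, $f_n\to f$ in $(\mathfrak{LC}_p,\mathcal T_D)$ and $x_{0,n}\to x_0$ in $\mathbb R^N$, then for every $[T_1,T_2]\subset I_{f,x_0}$ one has $[T_1,T_2]\subset I_{f_n,x_{0,n}}$ for all large $n$, and $x(\cdot,f_n,x_{0,n})\to x(\cdot,f,x_0)$ uniformly on $[T_1,T_2]$. (ii) Let $C\subset E$ be compact for $\mathcal T_D$. Then each $C^I_j$ is equicontinuous: for every $\varepsilon>0$ there is $\delta>0$ such that $|x(t)-x(s)|<\varepsilon$ for every $x\in C^I_j$ and all $s,t$ in its domain with $|t-s|<\delta$. Let $$\theta^I_j(r)=\sup\{|x(t)-x(s)| : x\in C^I_j,\ s,t \text{ in the domain of } x,\ |t-s|\le r\}\qquad(\sup\emptyset=0).$$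 Then $\theta^I_j$ is a modulus of continuity of all the functions in $C^I_j$, and $\Theta=\{\theta^I_j\}$ is a suitable set of moduli of continuity. (iii) Let $C\subset E$ be compact for $\mathcal T_D$, and let $\Theta$ be as in (ii). If $f_n\in C$ converges to $f$ in $(\mathfrak{LC}_p,\mathcal T_D)$, $F_n\to F$ in $(\Theta\mathfrak C_p(\mathbb R^{N\times N}),\mathcal T_\Theta)$, $h_n\to h$ in $(\Theta\mathfrak C_p(\mathbb R^N),\mathcal T_\Theta)$ and $(x_{0,n},y_{0,n})\to(x_0,y_0)$ in $\mathbb R^N\times\mathbb R^N$, then for every $[T_1,T_2]\subset I_{f,x_0}$ the maximal solution $(x,y)$ of $$\dot x=f(t,x),\quad \dot y=F(t,x)\,y+h(t,x),\quad x(0)=x_0,\ y(0)=y_0$$ is defined on $[T_1,T_2]$; so are, for all large $n$, the maximal solutions $(x_n,y_n)$ of the systems with data $(f_n,F_n,h_n,x_{0,n},y_{0,n})$; and $(x_n,y_n)\to(x,y)$ uniformly on $[T_1,T_2]$. -/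

import Mathlib

open MeasureTheory Set Filter Topology
open scoped ENNReal NNReal

noncomputable section

namespace Caratheodory

/-- The Euclidean space `ℝ^N`. -/
abbrev Eucl (N : ℕ) := EuclideanSpace ℝ (Fin N)

/-- The space `L^p_loc` of real functions of a real variable. -/
def LpLoc (p : ℝ≥0∞) (m : ℝ → ℝ) : Prop :=
  ∀ a b : ℝ, MemLp m p (volume.restrict (Icc a b))

/-- Borel functions `f : ℝ × ℝ^N → V` with an `m`-bound in `L^p_loc` on every compact set. -/
structure IsCarath {N : ℕ} {V : Type*} [NormedAddCommGroup V] [MeasurableSpace V] [BorelSpace V]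
    (p : ℝ≥0∞) (f : ℝ × Eucl N → V) : Prop where
  borel : Measurable f
  mbound : ∀ K : Set (Eucl N), IsCompact K →
    ∃ m : ℝ → ℝ, LpLoc p m ∧ ∀ᵐ t : ℝ, ∀ x ∈ K, ‖f (t, x)‖ ≤ m t

/-- The set of Lipschitz Caratheodory functions `ℝ × ℝ^N → ℝ^N` for the exponent `p`. -/
def LC (p : ℝ≥0∞) (N : ℕ) : Set (ℝ × Eucl N → Eucl N) :=
  {f | IsCarath p f ∧ ∀ K : Set (Eucl N), IsCompact K →
    ∃ l : ℝ → ℝ, LpLoc p l ∧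
      ∀ᵐ t : ℝ, ∀ x ∈ K, ∀ y ∈ K, ‖f (t, x) - f (t, y)‖ ≤ l t * ‖x - y‖}

/-- The optimal `l`-bound of `f` on the closed ball of radius `j` about the origin. -/
def lBound {N : ℕ} (f : ℝ × Eucl N → Eucl N) (j : ℕ) (t : ℝ) : ℝ≥0∞ :=
  ⨆ x ∈ Metric.closedBall (0 : Eucl N) j, ⨆ y ∈ Metric.closedBall (0 : Eucl N) j,
    ⨆ _ : x ≠ y, ‖f (t, x) - f (t, y)‖ₑ / ‖x - y‖ₑ

/-- The set `E` has `L^p_loc`-bounded `l`-bounds. -/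
def HasLpLocBoundedLBounds {p : ℝ≥0∞} {N : ℕ} (E : Set (LC p N)) : Prop :=
  ∀ j : ℕ, ∀ r : ℝ, 0 < r →
    ⨆ f ∈ E, eLpNorm (lBound (f : ℝ × Eucl N → Eucl N) j) p (volume.restrict (Icc (-r) r)) < ∞

/-- The topology on a set `S` of functions generated by a family `q` of seminorms: the balls
`{g ∈ S | q i (g - f) < ε}`, with `f ∈ S` and `ε > 0`, form a subbasis. -/
@[reducible] def seminormTopology {X V ι : Type*} [AddGroup V] (S : Set (X → V))
    (q : ι → (X → V) → ℝ≥0∞) : TopologicalSpace S :=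
  TopologicalSpace.generateFrom
    {U | ∃ (i : ι) (f : S) (ε : ℝ≥0∞), 0 < ε ∧
      U = {g : S | q i ((g : X → V) - (f : X → V)) < ε}}

/-- The compact real interval `[q₁, q₂]` with rational end points `q₁ ≤ q₂`. -/
def ratIcc (I : NonemptyInterval ℚ) : Set ℝ := Icc (I.fst : ℝ) (I.snd : ℝ)

/-- The topology `𝒯_D` on the set of Lipschitz Caratheodory functions, generated by the seminorms
`f ↦ ‖f(·, x)‖_{L^p(I)}` with `x ∈ D` and `I = [q₁, q₂]`, `q₁, q₂ ∈ ℚ`. -/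
@[reducible] def topD (p : ℝ≥0∞) {N : ℕ} (D : Set (Eucl N)) : TopologicalSpace (LC p N) :=
  seminormTopology (LC p N) fun (i : NonemptyInterval ℚ × D) f =>
    eLpNorm (fun t => f (t, (i.2 : Eucl N))) p (volume.restrict (ratIcc i.1))

/-- A suitable set of moduli of continuity. -/
structure IsSuitable (θ : NonemptyInterval ℚ → ℕ → ℝ≥0 → ℝ≥0) : Prop where
  monotone : ∀ I j, Monotone (θ I j)
  continuous : ∀ I j, Continuous (θ I j)
  zero : ∀ I j, θ I j 0 = 0
  le : ∀ I₁ I₂ j₁ j₂, ratIcc I₁ ⊆ ratIcc I₂ → j₁ ≤ j₂ → θ I₁ j₁ ≤ θ I₂ j₂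

/-- The continuous functions from `I` to the closed ball of radius `j` which admit `θ I j` as
modulus of continuity (only the values on `I` of a member matter). -/
def modSet (N : ℕ) (θ : NonemptyInterval ℚ → ℕ → ℝ≥0 → ℝ≥0) (I : NonemptyInterval ℚ) (j : ℕ) :
    Set (ℝ → Eucl N) :=
  {x | ContinuousOn x (ratIcc I) ∧ MapsTo x (ratIcc I) (Metric.closedBall 0 j) ∧
    ∀ s ∈ ratIcc I, ∀ t ∈ ratIcc I, nndist (x s) (x t) ≤ θ I j (nndist s t)}

/-- The set of `Θ`-Caratheodory functions `ℝ × ℝ^N → V` for the exponent `p`. -/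
def ThetaC (p : ℝ≥0∞) (N : ℕ) (θ : NonemptyInterval ℚ → ℕ → ℝ≥0 → ℝ≥0)
    (V : Type*) [NormedAddCommGroup V] [MeasurableSpace V] [BorelSpace V] :
    Set (ℝ × Eucl N → V) :=
  {f | IsCarath p f ∧ ∀ (I : NonemptyInterval ℚ) (j : ℕ) (x : ℕ → ℝ → Eucl N) (x₀ : ℝ → Eucl N),
    (∀ n, x n ∈ modSet N θ I j) → x₀ ∈ modSet N θ I j →
    TendstoUniformlyOn x x₀ atTop (ratIcc I) →
    Tendsto (fun n => eLpNorm (fun t => f (t, x n t) - f (t, x₀ t)) p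
      (volume.restrict (ratIcc I))) atTop (𝓝 0)}

/-- The topology `𝒯_Θ` on the set of `Θ`-Caratheodory functions, generated by the seminorms
`f ↦ sup_x ‖f(·, x(·))‖_{L^p(I)}`, where `x` ranges over `modSet N θ I j`. -/
@[reducible] def topTheta (p : ℝ≥0∞) (N : ℕ) (θ : NonemptyInterval ℚ → ℕ → ℝ≥0 → ℝ≥0)
    (V : Type*) [NormedAddCommGroup V] [MeasurableSpace V] [BorelSpace V] :
    TopologicalSpace (ThetaC p N θ V) :=
  seminormTopology (ThetaC p N θ V) fun (i : NonemptyInterval ℚ × ℕ) f =>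
    ⨆ x ∈ modSet N θ i.1 i.2, eLpNorm (fun t => f (t, x t)) p (volume.restrict (ratIcc i.1))

/-- `w` solves `ẇ = g(t, w)` on the interval `J`, in the integral (Caratheodory) sense. -/
def IsSolutionOn {W : Type*} [NormedAddCommGroup W] [NormedSpace ℝ W] (g : ℝ × W → W)
    (J : Set ℝ) (w : ℝ → W) : Prop :=
  J.OrdConnected ∧ ∀ s ∈ J, ∀ t ∈ J,
    IntervalIntegrable (fun u => g (u, w u)) volume s t ∧ w t = w s + ∫ u in s..t, g (u, w u)

/-- The maximal interval of existence of the Cauchy problem `ẇ = g(t, w)`, `w(0) = w₀`: the union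
of all the intervals containing `0` on which there is a solution. -/
def maxInterval {W : Type*} [NormedAddCommGroup W] [NormedSpace ℝ W] (g : ℝ × W → W)
    (w₀ : W) : Set ℝ :=
  {t | ∃ (J : Set ℝ) (w : ℝ → W), 0 ∈ J ∧ t ∈ J ∧ IsSolutionOn g J w ∧ w 0 = w₀}

/-- `w` is, on the maximal interval of existence, the solution of `ẇ = g(t, w)`, `w(0) = w₀`
(its values outside that interval do not matter). -/
def IsMaxSolution {W : Type*} [NormedAddCommGroup W] [NormedSpace ℝ W] (g : ℝ × W → W)
    (w₀ : W) (w : ℝ → W) : Prop :=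
  IsSolutionOn g (maxInterval g w₀) w ∧ w 0 = w₀

/-- The vector field of the triangular system `ẋ = f(t, x)`, `ẏ = F(t, x) y + h(t, x)`; the
`N × N` matrices are taken as linear operators on `ℝ^N`. -/
def triangular {N : ℕ} (f : ℝ × Eucl N → Eucl N) (F : ℝ × Eucl N → (Eucl N →L[ℝ] Eucl N))
    (h : ℝ × Eucl N → Eucl N) : ℝ × (Eucl N × Eucl N) → Eucl N × Eucl N :=
  fun q => (f (q.1, q.2.1), F (q.1, q.2.1) q.2.2 + h (q.1, q.2.1))

/-- The functions with values in the closed ball of radius `j`, defined on some interval `J ⊆ I`,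
which solve there `ẋ = f(t, x)` for some `f ∈ C`. A member is written as a pair `(J, x)`, and only
the values of `x` on `J` matter. -/
def solSet {p : ℝ≥0∞} {N : ℕ} (C : Set (LC p N)) (I : NonemptyInterval ℚ) (j : ℕ) :
    Set (Set ℝ × (ℝ → Eucl N)) :=
  {z | z.1 ⊆ ratIcc I ∧ MapsTo z.2 z.1 (Metric.closedBall 0 j) ∧
    ∃ f ∈ C, IsSolutionOn (f : ℝ × Eucl N → Eucl N) z.1 z.2}

/-- The (optimal) modulus of continuity of `solSet C I j`. The supremum is over a set of numbers
bounded by `2 * j`. -/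
def solModulus {p : ℝ≥0∞} {N : ℕ} (C : Set (LC p N)) (I : NonemptyInterval ℚ) (j : ℕ)
    (r : ℝ≥0) : ℝ≥0 :=
  sSup {d | ∃ z ∈ solSet C I j, ∃ s ∈ z.1, ∃ t ∈ z.1, nndist s t ≤ r ∧ d = nndist (z.2 s) (z.2 t)}

end Caratheodory

end

open Caratheodory

/-!
Convergence in `𝒯_D` only controls `f n (·, d)` for `d ∈ D`. On a set with bounded `l`-bounds this
is enough to control `f n (·, x (·))` for every curve `x` in a ball: choose a finite `η`-net
`S ⊆ D` of the ball; then `|f (t, x) - g (t, x)| ≤ ∑ d ∈ S, |f (t, d) - g (t, d)| + (l_f t + l_g t) η`,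
and the integrals of the Lipschitz coefficients are bounded, so `η` small makes the last term
small (`enorm_sub_le_sum_net`, `tendsto_lintegral_comp_of_topD`). With `g = 0` and the
equi-integrability of `f (·, d)` over a compact set `C`, the same inequality bounds the integral
of `f (t, x t)` over short intervals uniformly in `f ∈ C` and `x`
(`exists_setLIntegral_comp_le_of_isCompact`). This is the equicontinuity of the solutions; the
optimal modulus is continuous because it is subadditive and tends to `0` at `0`.

The equations themselves are handled by the weight `exp (4 |∫₀ᵗ l|)`: the integral from `0` to `t`
of `l` times the weight is at most half the weight at `t` (`abs_integral_mul_expWeight_le`). This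
gives Gronwall's inequality (`gronwall_abs`), hence the comparison of solutions of two equations
(`IsSolutionOn.norm_sub_le`), and global existence under a Lipschitz condition with integrable
coefficient (`exists_isSolutionOn_of_lipschitz`). For continuous dependence, the right-hand side
`f n` is truncated outside a ball containing the limit solution `x₀` in its interior; the global
solution of the truncated equation is close to `x₀`, since `f n (t, x₀ t) → f₀ (t, x₀ t)` in `L¹`,
and so it solves the original equation.

For the triangular system, the first components converge uniformly and, continued by constants,
belong to the sets of curves defining `𝒯_Θ`. The coefficients `F n (t, x n t)` and `h n (t, x n t)`
of the linear equation for the second component therefore converge in `L¹`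
(`tendsto_lintegral_comp_of_topTheta`), and the comparison of solutions applies again.
-/

namespace Caratheodory

/-! ### Gronwall's inequality with an integrable coefficient -/

/-- The weight `exp (4 |∫₀ᵗ l|)`. The optimal exponent for Gronwall's inequality would be `1`; the
larger one makes integration with density `l` a contraction with constant `1 / 2`. -/
noncomputable def expWeight (l : ℝ → ℝ) (t : ℝ) : ℝ := Real.exp (4 * |∫ v in (0 : ℝ)..t, l v|)

theorem expWeight_pos (l : ℝ → ℝ) (t : ℝ) : 0 < expWeight l t := Real.exp_pos _

theorem one_le_expWeight (l : ℝ → ℝ) (t : ℝ) : 1 ≤ expWeight l t :=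
  Real.one_le_exp (by positivity)

theorem continuous_expWeight {l : ℝ → ℝ} (hl : Integrable l) : Continuous (expWeight l) :=
  Real.continuous_exp.comp
    (continuous_const.mul (intervalIntegral.continuous_primitive (fun _ _ =>
      hl.intervalIntegrable) 0).abs)

theorem expWeight_neg (l : ℝ → ℝ) (t : ℝ) :
    expWeight l (-t) = expWeight (fun u => l (-u)) t := by
  simp only [expWeight]
  rw [intervalIntegral.integral_comp_neg, neg_zero, intervalIntegral.integral_symm, abs_neg]

theorem expWeight_le {l : ℝ → ℝ} (hl : Integrable l) (h0 : ∀ t, 0 ≤ l t) (t : ℝ) :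
    expWeight l t ≤ Real.exp (4 * ∫ v, l v) := by
  refine Real.exp_le_exp.2 (mul_le_mul_of_nonneg_left ?_ (by norm_num))
  rw [intervalIntegral.abs_intervalIntegral_eq, abs_of_nonneg (integral_nonneg h0)]
  exact setIntegral_le_integral hl (Eventually.of_forall h0)

theorem intervalIntegrable_mul_expWeight {l : ℝ → ℝ} (hl : Integrable l) (s t : ℝ) :
    IntervalIntegrable (fun u => l u * expWeight l u) volume s t :=
  hl.intervalIntegrable.mul_continuousOn (continuous_expWeight hl).continuousOn

/-- The derivative of the right-hand side is `2 l · expWeight l` almost everywhere. The inequality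
is propagated from `0` to the right by small steps, which avoids the almost everywhere differentiation
of the primitive of `l`. -/
theorem integral_mul_expWeight_le_of_nonneg {l : ℝ → ℝ} (hl : Integrable l) (h0 : ∀ t, 0 ≤ l t)
    {T : ℝ} (hT : 0 ≤ T) :
    ∫ u in (0 : ℝ)..T, l u * expWeight l u ≤ expWeight l T / 2 := by
  set L : ℝ → ℝ := fun t => ∫ v in (0 : ℝ)..t, l v with hL
  have hLc : Continuous L := intervalIntegral.continuous_primitive (fun _ _ =>
    hl.intervalIntegrable) 0
  have hLd : ∀ s t, L t - L s = ∫ v in s..t, l v := fun s t =>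
    intervalIntegral.integral_interval_sub_left hl.intervalIntegrable hl.intervalIntegrable
  have hLm : Monotone L := fun s t hst => by
    have := hLd s t
    have h2 : 0 ≤ ∫ v in s..t, l v := intervalIntegral.integral_nonneg hst fun u _ => h0 u
    linarith
  have hL0 : L 0 = 0 := by simp [hL]
  have hW : ∀ t, 0 ≤ t → expWeight l t = Real.exp (4 * L t) := fun t ht => by
    have : 0 ≤ L t := hL0 ▸ hLm ht
    simp only [expWeight]
    rw [abs_of_nonneg this]
  set P : ℝ → ℝ := fun t => ∫ u in (0 : ℝ)..t, l u * expWeight l u with hP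
  have hPc : Continuous P := intervalIntegral.continuous_primitive
    (intervalIntegrable_mul_expWeight hl) 0
  have key : Icc 0 T ⊆ {t | P t ≤ expWeight l t / 2} := by
    apply IsClosed.Icc_subset_of_forall_mem_nhdsWithin
    · exact (isClosed_le hPc ((continuous_expWeight hl).div_const 2)).inter isClosed_Icc
    · simp only [hP, mem_ofPred_eq, intervalIntegral.integral_same]
      exact div_nonneg (expWeight_pos l 0).le (by norm_num)
    · rintro x ⟨hx, hx0, -⟩
      have hev : ∀ᶠ t in 𝓝[>] x, L t < L x + 1 / 4 :=
        (hLc.continuousAt.mono_left nhdsWithin_le_nhds).eventually_lt_const (by linarith)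
      filter_upwards [hev, self_mem_nhdsWithin] with t ht hxt
      have hxt' : x ≤ t := le_of_lt hxt
      have ht0 : 0 ≤ t := hx0.trans hxt'
      have hstep : P t - P x ≤ expWeight l t * (L t - L x) := by
        rw [hLd, ← intervalIntegral.integral_const_mul]
        simp only [hP]
        rw [intervalIntegral.integral_interval_sub_left (intervalIntegrable_mul_expWeight hl _ _)
          (intervalIntegrable_mul_expWeight hl _ _)]
        refine intervalIntegral.integral_mono_on hxt' (intervalIntegrable_mul_expWeight hl _ _)
          (hl.intervalIntegrable.const_mul _) fun u hu => ?_
        rw [mul_comm]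
        refine mul_le_mul_of_nonneg_right ?_ (h0 u)
        rw [hW u (hx0.trans hu.1), hW t ht0]
        exact Real.exp_le_exp.2 (by linarith [hLm hu.2])
      have hd0 : 0 ≤ L t - L x := by linarith [hLm hxt']
      -- The exponent `4` leaves room for the elementary bound `exp (-4 d) ≤ 1 - 2 d`.
      have hexp : Real.exp (-(4 * (L t - L x))) ≤ 1 - 2 * (L t - L x) := by
        rw [Real.exp_neg]
        have h1 := Real.add_one_le_exp (4 * (L t - L x))
        rw [inv_le_iff_one_le_mul₀ (Real.exp_pos _)]
        have : 0 ≤ 1 - 2 * (L t - L x) := by linarith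
        nlinarith
      have hxW : expWeight l x ≤ expWeight l t * (1 - 2 * (L t - L x)) := by
        have : expWeight l x = expWeight l t * Real.exp (-(4 * (L t - L x))) := by
          rw [hW x hx0, hW t ht0, ← Real.exp_add]
          congr 1
          ring
        rw [this]
        exact mul_le_mul_of_nonneg_left hexp (expWeight_pos l t).le
      simp only [mem_ofPred_eq] at hx ⊢
      linarith
  exact key ⟨hT, le_rfl⟩

theorem abs_integral_mul_expWeight_le {l : ℝ → ℝ} (hl : Integrable l) (h0 : ∀ t, 0 ≤ l t)
    (t : ℝ) : |∫ u in (0 : ℝ)..t, l u * expWeight l u| ≤ expWeight l t / 2 := by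
  have hpos : ∀ {l : ℝ → ℝ}, Integrable l → (∀ t, 0 ≤ l t) → ∀ {t : ℝ}, 0 ≤ t →
      |∫ u in (0 : ℝ)..t, l u * expWeight l u| ≤ expWeight l t / 2 := fun {l} hl h0 {t} ht => by
    rw [abs_of_nonneg (intervalIntegral.integral_nonneg ht fun u _ =>
      mul_nonneg (h0 u) (expWeight_pos l u).le)]
    exact integral_mul_expWeight_le_of_nonneg hl h0 ht
  rcases le_total 0 t with ht | ht
  · exact hpos hl h0 ht
  · have h := hpos (l := fun u => l (-u)) hl.comp_neg (fun u => h0 _) (neg_nonneg.2 ht)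
    simp only [← expWeight_neg, neg_neg] at h
    have e := intervalIntegral.integral_comp_neg (a := 0) (b := -t)
      (fun u => l u * expWeight l u)
    simp only [neg_neg, neg_zero] at e
    rwa [e, intervalIntegral.integral_symm, abs_neg] at h

/-- Gronwall's inequality on both sides of the origin, with an integrable coefficient; the
constants are not optimal. -/
theorem gronwall_abs {l u : ℝ → ℝ} {T₁ T₂ c : ℝ} (hl : Integrable l) (h0 : ∀ t, 0 ≤ l t)
    (hT : (0 : ℝ) ∈ Icc T₁ T₂) (hu : ContinuousOn u (Icc T₁ T₂)) (hu0 : ∀ t ∈ Icc T₁ T₂, 0 ≤ u t)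
    (h : ∀ t ∈ Icc T₁ T₂, u t ≤ c + |∫ s in (0 : ℝ)..t, l s * u s|) :
    ∀ t ∈ Icc T₁ T₂, u t ≤ 2 * c * Real.exp (4 * ∫ s, l s) := by
  -- It suffices to bound the maximum of `u / expWeight l`, which the integral term at most halves.
  obtain ⟨τ, hτ, hmax⟩ := isCompact_Icc.exists_isMaxOn ⟨0, hT⟩
    (hu.div (continuous_expWeight hl).continuousOn fun t _ => (expWeight_pos l t).ne')
  set S := u τ / expWeight l τ with hS
  have hS0 : 0 ≤ S := div_nonneg (hu0 τ hτ) (expWeight_pos l τ).le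
  have hle : ∀ t ∈ Icc T₁ T₂, u t ≤ S * expWeight l t := fun t ht =>
    (div_le_iff₀ (expWeight_pos l t)).1 (hmax ht)
  have hint : |∫ s in (0 : ℝ)..τ, l s * u s| ≤ S * (expWeight l τ / 2) := by
    have h1 : ‖∫ s in (0 : ℝ)..τ, l s * u s‖ ≤
        |∫ s in (0 : ℝ)..τ, S * (l s * expWeight l s)| := by
      refine intervalIntegral.norm_integral_le_abs_of_norm_le ?_
        ((intervalIntegrable_mul_expWeight hl _ _).const_mul S)
      refine (ae_restrict_mem measurableSet_uIoc).mono fun s hs => ?_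
      have hs' : s ∈ Icc T₁ T₂ := uIcc_subset_Icc hT hτ (uIoc_subset_uIcc hs)
      rw [Real.norm_of_nonneg (mul_nonneg (h0 s) (hu0 s hs'))]
      calc l s * u s ≤ l s * (S * expWeight l s) :=
            mul_le_mul_of_nonneg_left (hle s hs') (h0 s)
        _ = S * (l s * expWeight l s) := by ring
    refine h1.trans ?_
    rw [intervalIntegral.integral_const_mul, abs_mul, abs_of_nonneg hS0]
    exact mul_le_mul_of_nonneg_left (abs_integral_mul_expWeight_le hl h0 τ) hS0
  have hτu : S * expWeight l τ = u τ := div_mul_cancel₀ _ (expWeight_pos l τ).ne'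
  have hSc : S ≤ 2 * c := by
    have := h τ hτ
    have h1 : S * 1 ≤ S * expWeight l τ := mul_le_mul_of_nonneg_left (one_le_expWeight l τ) hS0
    linarith
  intro t ht
  exact (hle t ht).trans (mul_le_mul hSc (expWeight_le hl h0 t) (expWeight_pos l t).le
    (hS0.trans hSc))

/-! ### Solutions in the integral sense -/

section Solutions

variable {W : Type*} [NormedAddCommGroup W] [NormedSpace ℝ W] {g g' : ℝ × W → W} {u v w : ℝ → W}
  {T₁ T₂ : ℝ} {w₀ : W}

theorem IsSolutionOn.mono {J J' : Set ℝ} (h : IsSolutionOn g J w) (hJ : J'.OrdConnected)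
    (hsub : J' ⊆ J) : IsSolutionOn g J' w :=
  ⟨hJ, fun s hs t ht => h.2 s (hsub hs) t (hsub ht)⟩

theorem IsSolutionOn.integrableOn (h : IsSolutionOn g (Icc T₁ T₂) w) :
    IntegrableOn (fun t => g (t, w t)) (Icc T₁ T₂) := by
  rcases le_or_gt T₁ T₂ with hle | hlt
  · exact (intervalIntegrable_iff_integrableOn_Icc_of_le hle).1
      (h.2 T₁ (left_mem_Icc.2 hle) T₂ (right_mem_Icc.2 hle)).1
  · simp [Icc_eq_empty hlt.not_ge]

theorem IsSolutionOn.continuousOn (h : IsSolutionOn g (Icc T₁ T₂) w) :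
    ContinuousOn w (Icc T₁ T₂) := by
  rcases le_or_gt T₁ T₂ with hle | hlt
  · have hc : ContinuousOn (fun t => w T₁ + ∫ u in T₁..t, g (u, w u)) (Icc T₁ T₂) := by
      have := intervalIntegral.continuousOn_primitive_interval
        (by rw [uIcc_of_le hle]; exact h.integrableOn)
      rw [uIcc_of_le hle] at this
      exact continuousOn_const.add this
    exact hc.congr fun t ht => (h.2 T₁ (left_mem_Icc.2 hle) t ht).2
  · simp [Icc_eq_empty hlt.not_ge]

theorem isSolutionOn_Icc_of_integral (hT : (0 : ℝ) ∈ Icc T₁ T₂)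
    (hi : IntegrableOn (fun t => g (t, w t)) (Icc T₁ T₂))
    (h : ∀ t ∈ Icc T₁ T₂, w t = w 0 + ∫ u in (0 : ℝ)..t, g (u, w u)) :
    IsSolutionOn g (Icc T₁ T₂) w := by
  have hii : ∀ s ∈ Icc T₁ T₂, ∀ t ∈ Icc T₁ T₂,
      IntervalIntegrable (fun u => g (u, w u)) volume s t := fun s hs t ht =>
    intervalIntegrable_iff.2 (hi.mono_set (uIoc_subset_uIcc.trans (uIcc_subset_Icc hs ht)))
  refine ⟨ordConnected_Icc, fun s hs t ht => ⟨hii s hs t ht, ?_⟩⟩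
  rw [h t ht, h s hs, add_assoc,
    intervalIntegral.integral_add_adjacent_intervals (hii 0 hT s hs) (hii s hs t ht)]

theorem IsSolutionOn.congr (h : IsSolutionOn g (Icc T₁ T₂) v)
    (he : ∀ t ∈ Icc T₁ T₂, g (t, v t) = g' (t, w t)) (hvw : EqOn v w (Icc T₁ T₂)) :
    IsSolutionOn g' (Icc T₁ T₂) w := by
  refine ⟨ordConnected_Icc, fun s hs t ht => ?_⟩
  have e : EqOn (fun u => g (u, v u)) (fun u => g' (u, w u)) (uIcc s t) := fun u hu =>
    he u (uIcc_subset_Icc hs ht hu)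
  obtain ⟨h1, h2⟩ := h.2 s hs t ht
  refine ⟨h1.congr (e.mono uIoc_subset_uIcc), ?_⟩
  rw [← hvw ht, ← hvw hs, h2, intervalIntegral.integral_congr e]

theorem IsSolutionOn.subset_maxInterval (h : IsSolutionOn g (Icc T₁ T₂) w)
    (hT : (0 : ℝ) ∈ Icc T₁ T₂) (hw : w 0 = w₀) : Icc T₁ T₂ ⊆ maxInterval g w₀ :=
  fun _ ht => ⟨_, w, hT, ht, h, hw⟩

theorem uIcc_subset_maxInterval {t : ℝ} (ht : t ∈ maxInterval g w₀) :
    uIcc 0 t ⊆ maxInterval g w₀ := by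
  obtain ⟨J, w, h0, htJ, hw, hw0⟩ := ht
  exact fun s hs => ⟨J, w, h0, hw.1.uIcc_subset h0 htJ hs, hw, hw0⟩

theorem Icc_min_max_subset_maxInterval (hle : T₁ ≤ T₂) (h : Icc T₁ T₂ ⊆ maxInterval g w₀) :
    Icc (min T₁ 0) (max T₂ 0) ⊆ maxInterval g w₀ := by
  intro t ht
  rcases le_total 0 t with h0 | h0
  · rcases le_total T₂ 0 with h2 | h2
    · rw [max_eq_right h2] at ht
      rw [le_antisymm ht.2 h0]
      exact uIcc_subset_maxInterval (h (left_mem_Icc.2 hle)) left_mem_uIcc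
    · rw [max_eq_left h2] at ht
      exact uIcc_subset_maxInterval (h (right_mem_Icc.2 hle)) (mem_uIcc_of_le h0 ht.2)
  · rcases le_total T₁ 0 with h1 | h1
    · rw [min_eq_left h1] at ht
      exact uIcc_subset_maxInterval (h (left_mem_Icc.2 hle)) (mem_uIcc_of_ge ht.1 h0)
    · rw [min_eq_right h1] at ht
      rw [le_antisymm h0 ht.1]
      exact uIcc_subset_maxInterval (h (left_mem_Icc.2 hle)) left_mem_uIcc

/-- Two solutions, one to the left and one to the right of the origin, are glued at `0`; this needs
no uniqueness. -/
theorem exists_isSolutionOn_of_Icc_subset_maxInterval (hT : (0 : ℝ) ∈ Icc T₁ T₂)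
    (h : Icc T₁ T₂ ⊆ maxInterval g w₀) : ∃ w, IsSolutionOn g (Icc T₁ T₂) w ∧ w 0 = w₀ := by
  have hle : T₁ ≤ T₂ := hT.1.trans hT.2
  obtain ⟨J₁, w₁, h01, hT1, hw1, hw10⟩ := h (left_mem_Icc.2 hle)
  obtain ⟨J₂, w₂, h02, hT2, hw2, hw20⟩ := h (right_mem_Icc.2 hle)
  have s1 := hw1.mono ordConnected_Icc (hw1.1.out hT1 h01)
  have s2 := hw2.mono ordConnected_Icc (hw2.1.out h02 hT2)
  set w : ℝ → W := fun t => if t ≤ 0 then w₁ t else w₂ t with hw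
  have e1 : EqOn w₁ w (Icc T₁ 0) := fun t ht => by simp [hw, ht.2]
  have e2 : EqOn w₂ w (Icc 0 T₂) := fun t ht => by
    rcases ht.1.eq_or_lt with h | h
    · simp [hw, ← h, hw10, hw20]
    · simp [hw, h.not_ge]
  have s1' : IsSolutionOn g (Icc T₁ 0) w := s1.congr (fun t ht => by rw [e1 ht]) e1
  have s2' : IsSolutionOn g (Icc 0 T₂) w := s2.congr (fun t ht => by rw [e2 ht]) e2
  refine ⟨w, isSolutionOn_Icc_of_integral hT ?_ fun t ht => ?_, by simp [hw, hw10]⟩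
  · rw [← Icc_union_Icc_eq_Icc hT.1 hT.2]
    exact s1'.integrableOn.union s2'.integrableOn
  · rcases le_total t 0 with h | h
    · exact (s1'.2 0 ⟨hT.1, le_rfl⟩ t ⟨ht.1, h⟩).2
    · exact (s2'.2 0 ⟨le_rfl, hT.2⟩ t ⟨h, ht.2⟩).2

/-- Solutions of two equations stay close if the right-hand sides are related, along the two
solutions, by a Lipschitz-type estimate with an integrable defect `k`. -/
theorem IsSolutionOn.norm_sub_le {l k : ℝ → ℝ} (hT : (0 : ℝ) ∈ Icc T₁ T₂)
    (hu : IsSolutionOn g (Icc T₁ T₂) u) (hv : IsSolutionOn g' (Icc T₁ T₂) v)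
    (hl : Integrable l) (h0 : ∀ t, 0 ≤ l t) (hk : IntegrableOn k (Icc T₁ T₂)) (hk0 : ∀ t, 0 ≤ k t)
    (h : ∀ᵐ t ∂volume.restrict (Icc T₁ T₂),
      ‖g (t, u t) - g' (t, v t)‖ ≤ l t * ‖u t - v t‖ + k t) :
    ∀ t ∈ Icc T₁ T₂, ‖u t - v t‖ ≤
      2 * (‖u 0 - v 0‖ + ∫ t in Icc T₁ T₂, k t) * Real.exp (4 * ∫ s, l s) := by
  have hcont : ContinuousOn (fun t => ‖u t - v t‖) (Icc T₁ T₂) :=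
    (hu.continuousOn.sub hv.continuousOn).norm
  refine gronwall_abs hl h0 hT hcont (fun _ _ => norm_nonneg _) fun t ht => ?_
  obtain ⟨hui, hut⟩ := hu.2 0 hT t ht
  obtain ⟨hvi, hvt⟩ := hv.2 0 hT t ht
  have hsub : uIcc 0 t ⊆ Icc T₁ T₂ := uIcc_subset_Icc hT ht
  have hsub' : uIoc 0 t ⊆ Icc T₁ T₂ := uIoc_subset_uIcc.trans hsub
  have hli : IntervalIntegrable (fun s => l s * ‖u s - v s‖) volume 0 t :=
    hl.intervalIntegrable.mul_continuousOn (hcont.mono hsub)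
  have hki : IntervalIntegrable k volume 0 t := intervalIntegrable_iff.2 (hk.mono_set hsub')
  have e : u t - v t = (u 0 - v 0) + ∫ s in (0 : ℝ)..t, (g (s, u s) - g' (s, v s)) := by
    rw [intervalIntegral.integral_sub hui hvi, hut, hvt]
    abel
  have h1 : ‖∫ s in (0 : ℝ)..t, (g (s, u s) - g' (s, v s))‖ ≤
      |∫ s in (0 : ℝ)..t, (l s * ‖u s - v s‖ + k s)| :=
    intervalIntegral.norm_integral_le_abs_of_norm_le
      (ae_restrict_of_ae_restrict_of_subset hsub' h) (hli.add hki)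
  rw [intervalIntegral.integral_add hli hki] at h1
  have h2 : |∫ s in (0 : ℝ)..t, k s| ≤ ∫ t in Icc T₁ T₂, k t := by
    rw [intervalIntegral.abs_intervalIntegral_eq, abs_of_nonneg (integral_nonneg hk0)]
    exact setIntegral_mono_set hk (Eventually.of_forall hk0) hsub'.eventuallyLE
  calc ‖u t - v t‖ ≤ ‖u 0 - v 0‖ + ‖∫ s in (0 : ℝ)..t, (g (s, u s) - g' (s, v s))‖ := by
        rw [e]; exact norm_add_le _ _
    _ ≤ ‖u 0 - v 0‖ + (|∫ s in (0 : ℝ)..t, l s * ‖u s - v s‖| + |∫ s in (0 : ℝ)..t, k s|) := by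
        gcongr
        exact h1.trans (abs_add_le _ _)
    _ ≤ _ := by linarith

/-- Global existence for a right-hand side with an integrable global Lipschitz coefficient: in the
weight `expWeight l` the Picard operator halves distances, hence one of its iterates is a
contraction of the space of continuous functions. -/
theorem exists_isSolutionOn_of_lipschitz [CompleteSpace W] {l : ℝ → ℝ} (hT : (0 : ℝ) ∈ Icc T₁ T₂)
    (hl : Integrable l) (h0 : ∀ t, 0 ≤ l t)
    (hg : ∀ w : ℝ → W, Continuous w → IntegrableOn (fun t => g (t, w t)) (Icc T₁ T₂))
    (h : ∀ᵐ t ∂volume.restrict (Icc T₁ T₂), ∀ x y : W, ‖g (t, x) - g (t, y)‖ ≤ l t * ‖x - y‖)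
    (w₀ : W) : ∃ w, IsSolutionOn g (Icc T₁ T₂) w ∧ w 0 = w₀ := by
  have hle : T₁ ≤ T₂ := hT.1.trans hT.2
  let ext : C(Icc T₁ T₂, W) → ℝ → W := fun x => IccExtend hle x
  have hext : ∀ x, Continuous (ext x) := fun x => x.continuous.Icc_extend'
  have hint : ∀ x, IntegrableOn (fun t => g (t, ext x t)) (Icc T₁ T₂) := fun x => hg _ (hext x)
  have hii : ∀ x, ∀ s ∈ Icc T₁ T₂, ∀ t ∈ Icc T₁ T₂,
      IntervalIntegrable (fun u => g (u, ext x u)) volume s t := fun x s hs t ht =>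
    intervalIntegrable_iff.2 ((hint x).mono_set (uIoc_subset_uIcc.trans (uIcc_subset_Icc hs ht)))
  have hcont : ∀ x, ContinuousOn (fun t => w₀ + ∫ u in (0 : ℝ)..t, g (u, ext x u))
      (Icc T₁ T₂) := fun x => by
    have := intervalIntegral.continuousOn_primitive_interval' (a := 0)
      (hii x T₁ (left_mem_Icc.2 hle) T₂ (right_mem_Icc.2 hle)) (by rwa [uIcc_of_le hle])
    rw [uIcc_of_le hle] at this
    exact continuousOn_const.add this
  let Φ : C(Icc T₁ T₂, W) → C(Icc T₁ T₂, W) := fun x =>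
    ⟨fun t => w₀ + ∫ u in (0 : ℝ)..t, g (u, ext x u), (hcont x).domRestrict⟩
  have hextval : ∀ (x : C(Icc T₁ T₂, W)) (t : Icc T₁ T₂), ext x t = x t := fun x t =>
    IccExtend_val hle x t
  have hhalf : ∀ (x y : C(Icc T₁ T₂, W)) (c : ℝ), 0 ≤ c →
      (∀ t : Icc T₁ T₂, ‖x t - y t‖ ≤ c * expWeight l t) →
      ∀ t : Icc T₁ T₂, ‖Φ x t - Φ y t‖ ≤ c / 2 * expWeight l t := by
    intro x y c hc hxy t
    have hsub : uIoc 0 (t : ℝ) ⊆ Icc T₁ T₂ := uIoc_subset_uIcc.trans (uIcc_subset_Icc hT t.2)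
    have e : Φ x t - Φ y t = ∫ u in (0 : ℝ)..t, (g (u, ext x u) - g (u, ext y u)) := by
      rw [intervalIntegral.integral_sub (hii x 0 hT t t.2) (hii y 0 hT t t.2)]
      exact add_sub_add_left_eq_sub _ _ _
    have h1 : ‖∫ u in (0 : ℝ)..t, (g (u, ext x u) - g (u, ext y u))‖ ≤
        |∫ u in (0 : ℝ)..t, c * (l u * expWeight l u)| := by
      refine intervalIntegral.norm_integral_le_abs_of_norm_le ?_
        ((intervalIntegrable_mul_expWeight hl _ _).const_mul c)
      filter_upwards [ae_restrict_of_ae_restrict_of_subset hsub h,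
        ae_restrict_mem measurableSet_uIoc] with s hs hsm
      refine (hs _ _).trans ?_
      have := hxy ⟨s, hsub hsm⟩
      rw [← hextval, ← hextval] at this
      calc l s * ‖ext x s - ext y s‖ ≤ l s * (c * expWeight l s) :=
            mul_le_mul_of_nonneg_left this (h0 s)
        _ = c * (l s * expWeight l s) := by ring
    rw [e]
    refine h1.trans ?_
    rw [intervalIntegral.integral_const_mul, abs_mul, abs_of_nonneg hc]
    calc c * |∫ u in (0 : ℝ)..t, l u * expWeight l u| ≤ c * (expWeight l t / 2) :=
          mul_le_mul_of_nonneg_left (abs_integral_mul_expWeight_le hl h0 t) hc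
      _ = c / 2 * expWeight l t := by ring
  have hiter : ∀ (n : ℕ) (x y : C(Icc T₁ T₂, W)) (t : Icc T₁ T₂),
      ‖Φ^[n] x t - Φ^[n] y t‖ ≤ dist x y * (1 / 2) ^ n * expWeight l t := by
    intro n x y
    induction n with
    | zero =>
      intro t
      simp only [Function.iterate_zero, id, pow_zero, mul_one]
      rw [← dist_eq_norm]
      exact (ContinuousMap.dist_apply_le_dist t).trans
        (le_mul_of_one_le_right dist_nonneg (one_le_expWeight l t))
    | succ n ih =>
      intro t
      rw [Function.iterate_succ_apply', Function.iterate_succ_apply']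
      have := hhalf _ _ _ (by positivity) ih t
      rwa [pow_succ, ← mul_assoc, mul_one_div]
  obtain ⟨n, hn⟩ := exists_pow_lt_of_lt_one
    (show (0 : ℝ) < 1 / 2 / Real.exp (4 * ∫ s, l s) by positivity)
    (show (1 / 2 : ℝ) < 1 by norm_num)
  have hcontr : ContractingWith (1 / 2) Φ^[n] := by
    refine ⟨by rw [← NNReal.coe_lt_coe]; norm_num, LipschitzWith.of_dist_le_mul fun x y => ?_⟩
    rw [ContinuousMap.dist_le (by positivity)]
    intro t
    rw [dist_eq_norm]
    refine (hiter n x y t).trans ?_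
    rw [lt_div_iff₀ (Real.exp_pos _)] at hn
    have h2 : (1 / 2 : ℝ) ^ n * expWeight l t ≤ 1 / 2 :=
      (mul_le_mul_of_nonneg_left (expWeight_le hl h0 t) (by positivity)).trans hn.le
    calc dist x y * (1 / 2) ^ n * expWeight l t = dist x y * ((1 / 2) ^ n * expWeight l t) := by
          ring
      _ ≤ dist x y * (1 / 2) := mul_le_mul_of_nonneg_left h2 dist_nonneg
      _ = ((1 / 2 : ℝ≥0) : ℝ) * dist x y := by push_cast; ring
  have hfix := hcontr.isFixedPt_fixedPoint_iterate
  set x := ContractingWith.fixedPoint Φ^[n] hcontr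
  have hval : ∀ t ∈ Icc T₁ T₂, ext x t = w₀ + ∫ u in (0 : ℝ)..t, g (u, ext x u) := fun t ht => by
    have := DFunLike.congr_fun hfix ⟨t, ht⟩
    rw [hextval x ⟨t, ht⟩, ← this]
    rfl
  have hzero : ext x 0 = w₀ := by simpa using hval 0 hT
  exact ⟨ext x, isSolutionOn_Icc_of_integral hT (hint x) fun t ht => by rw [hzero, hval t ht],
    hzero⟩

end Solutions

/-! ### `L^p` and `L¹` on bounded intervals -/

section Integrals

theorem lintegral_enorm_le_eLpNorm {α V : Type*} [MeasurableSpace α] [NormedAddCommGroup V]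
    {μ : Measure α} {p : ℝ≥0∞} (hp1 : 1 ≤ p) {g : α → V} (hg : AEStronglyMeasurable g μ) :
    ∫⁻ t, ‖g t‖ₑ ∂μ ≤ eLpNorm g p μ * μ univ ^ (1 - 1 / p.toReal) := by
  rw [← eLpNorm_one_eq_lintegral_enorm]
  simpa using eLpNorm_le_eLpNorm_mul_rpow_measure_univ hp1 hg

theorem measure_univ_rpow_ne_top {α : Type*} [MeasurableSpace α] (μ : Measure α)
    [IsFiniteMeasure μ] {p : ℝ≥0∞} (hp1 : 1 ≤ p) : μ univ ^ (1 - 1 / p.toReal) ≠ ∞ := by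
  refine ENNReal.rpow_ne_top_of_nonneg ?_ (measure_ne_top μ univ)
  rcases eq_or_ne p ∞ with rfl | hp
  · simp
  · have : 1 ≤ p.toReal := by simpa using ENNReal.toReal_mono hp hp1
    rw [sub_nonneg, div_le_one (by linarith)]
    exact this

theorem tendsto_lintegral_enorm_of_tendsto_eLpNorm {α ι V : Type*} [MeasurableSpace α]
    [NormedAddCommGroup V] {μ : Measure α} [IsFiniteMeasure μ] {p : ℝ≥0∞} (hp1 : 1 ≤ p)
    {L : Filter ι} {g : ι → α → V} (hg : ∀ n, AEStronglyMeasurable (g n) μ)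
    (h : Tendsto (fun n => eLpNorm (g n) p μ) L (𝓝 0)) :
    Tendsto (fun n => ∫⁻ t, ‖g n t‖ₑ ∂μ) L (𝓝 0) := by
  have := ENNReal.Tendsto.mul_const h (Or.inr (measure_univ_rpow_ne_top μ hp1))
  rw [zero_mul] at this
  exact tendsto_of_tendsto_of_tendsto_of_le_of_le tendsto_const_nhds this (fun _ => zero_le)
    fun n => lintegral_enorm_le_eLpNorm hp1 (hg n)

theorem exists_subset_ratIcc (a b : ℝ) : ∃ I : NonemptyInterval ℚ, Icc a b ⊆ ratIcc I := by
  obtain ⟨q, hq⟩ := exists_rat_lt a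
  obtain ⟨r, hr⟩ := exists_rat_gt b
  exact ⟨⟨(min q r, r), min_le_right _ _⟩, Icc_subset_Icc
    ((Rat.cast_le.2 (min_le_left q r)).trans hq.le) hr.le⟩

instance isFiniteMeasure_restrict_ratIcc (I : NonemptyInterval ℚ) :
    IsFiniteMeasure (volume.restrict (ratIcc I)) :=
  inferInstanceAs (IsFiniteMeasure (volume.restrict (Icc _ _)))

end Integrals

/-! ### Neighbourhoods for the seminorm topologies -/

section Seminorms

theorem isOpen_seminormTopology_ball {X V ι : Type*} [AddGroup V] (S : Set (X → V))
    (q : ι → (X → V) → ℝ≥0∞) (i : ι) (f : S) {ε : ℝ≥0∞} (hε : 0 < ε) :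
    IsOpen[seminormTopology S q] {g : S | q i ((g : X → V) - (f : X → V)) < ε} :=
  TopologicalSpace.isOpen_generateFrom_of_mem ⟨i, f, ε, hε, rfl⟩

theorem ball_mem_nhds_seminormTopology {X V ι : Type*} [AddGroup V] (S : Set (X → V))
    (q : ι → (X → V) → ℝ≥0∞) {i : ι} (hq : q i 0 = 0) (f : S) {ε : ℝ≥0∞} (hε : 0 < ε) :
    {g : S | q i ((g : X → V) - (f : X → V)) < ε} ∈ @nhds _ (seminormTopology S q) f :=
  @IsOpen.mem_nhds _ (seminormTopology S q) _ _ (isOpen_seminormTopology_ball S q i f hε)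
    (by simpa [hq] using hε)

theorem tendsto_seminorm_sub {X V ι κ : Type*} [AddGroup V] {S : Set (X → V)}
    {q : ι → (X → V) → ℝ≥0∞} {i : ι} (hq : q i 0 = 0) {L : Filter κ} {f : κ → S} {f₀ : S}
    (h : Tendsto f L (@nhds _ (seminormTopology S q) f₀)) :
    Tendsto (fun n => q i ((f n : X → V) - (f₀ : X → V))) L (𝓝 0) := by
  rw [ENNReal.tendsto_nhds_zero]
  exact fun ε hε =>
    (h.eventually (ball_mem_nhds_seminormTopology S q hq f₀ hε)).mono fun _ hn => le_of_lt hn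

end Seminorms

variable {N : ℕ} {p : ℝ≥0∞}

/-! ### Bounds and Lipschitz coefficients of Caratheodory functions -/

section Bounds

theorem IsCarath.measurable_left {V : Type*} [NormedAddCommGroup V] [MeasurableSpace V]
    [BorelSpace V] {f : ℝ × Eucl N → V} (hf : IsCarath p f) (x : Eucl N) :
    Measurable fun t => f (t, x) := hf.borel.comp (measurable_id.prodMk measurable_const)

theorem IsCarath.memLp_comp {V : Type*} [NormedAddCommGroup V] [MeasurableSpace V]
    [BorelSpace V] [SecondCountableTopology V] {f : ℝ × Eucl N → V} (hf : IsCarath p f)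
    {a b : ℝ} {x : ℝ → Eucl N} (hx : ContinuousOn x (Icc a b)) :
    MemLp (fun t => f (t, x t)) p (volume.restrict (Icc a b)) := by
  obtain ⟨m, hm, hfm⟩ := hf.mbound _ (isCompact_Icc.image_of_continuousOn hx)
  have hmeas : AEMeasurable (fun t => f (t, x t)) (volume.restrict (Icc a b)) :=
    hf.borel.comp_aemeasurable (aemeasurable_id.prodMk (hx.aemeasurable measurableSet_Icc))
  refine (hm a b).mono' hmeas.aestronglyMeasurable ?_
  filter_upwards [ae_restrict_of_ae hfm, ae_restrict_mem measurableSet_Icc] with t ht hmem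
  exact ht _ (mem_image_of_mem x hmem)

theorem IsCarath.integrableOn_comp {V : Type*} [NormedAddCommGroup V] [MeasurableSpace V]
    [BorelSpace V] [SecondCountableTopology V] (hp1 : 1 ≤ p) {f : ℝ × Eucl N → V}
    (hf : IsCarath p f) {a b : ℝ} {x : ℝ → Eucl N} (hx : ContinuousOn x (Icc a b)) :
    IntegrableOn (fun t => f (t, x t)) (Icc a b) :=
  (hf.memLp_comp hx).integrable hp1

theorem exists_lipschitz_of_mem_LC (hp1 : 1 ≤ p) {f : ℝ × Eucl N → Eucl N} (hf : f ∈ LC p N)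
    {K : Set (Eucl N)} (hK : IsCompact K) (a b : ℝ) :
    ∃ l : ℝ → ℝ≥0, Measurable l ∧ ∫⁻ t in Icc a b, l t < ∞ ∧
      ∀ᵐ t ∂volume.restrict (Icc a b), LipschitzOnWith (l t) (fun x => f (t, x)) K := by
  obtain ⟨l, hl, hfl⟩ := hf.2 K hK
  have hm := hl a b
  have hsm := hm.aestronglyMeasurable
  have hi : Integrable l (volume.restrict (Icc a b)) := hm.integrable hp1
  refine ⟨fun t => (hsm.mk l t).toNNReal, hsm.stronglyMeasurable_mk.measurable.real_toNNReal,
    ?_, ?_⟩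
  · refine lt_of_le_of_lt (lintegral_mono_ae ?_) hi.2
    filter_upwards [hsm.ae_eq_mk] with t ht
    rw [← ht, ← ENNReal.ofReal]
    exact Real.ofReal_le_enorm _
  · filter_upwards [ae_restrict_of_ae hfl, hsm.ae_eq_mk] with t ht hmk
    refine LipschitzOnWith.of_dist_le_mul fun x hx y hy => ?_
    rw [dist_eq_norm, dist_eq_norm, ← hmk]
    exact (ht x hx y hy).trans
      (mul_le_mul_of_nonneg_right (Real.le_coe_toNNReal _) (norm_nonneg _))

/-- The members of a set with `L^p_loc`-bounded `l`-bounds admit measurable Lipschitz coefficients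
on a ball with a common bound for their integrals. The coefficient is the supremum of the
difference quotients over a countable dense subset of the ball, which is measurable, while the
supremum over the whole ball need not be. -/
theorem HasLpLocBoundedLBounds.exists_lipschitz (hp1 : 1 ≤ p) {E : Set (LC p N)}
    (hE : HasLpLocBoundedLBounds E) (j : ℕ) (a b : ℝ) :
    ∃ M : ℝ≥0, ∀ f ∈ E, ∃ l : ℝ → ℝ≥0, Measurable l ∧ ∫⁻ t in Icc a b, l t ≤ M ∧
      ∀ᵐ t ∂volume.restrict (Icc a b), LipschitzOnWith (l t)
        (fun x => (f : ℝ × Eucl N → Eucl N) (t, x)) (Metric.closedBall 0 j) := by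
  set r : ℝ := max |a| |b| + 1 with hr
  have hr0 : 0 < r := by positivity
  have hsub : Icc a b ⊆ Icc (-r) r := by
    refine Icc_subset_Icc ?_ ?_
    · linarith [neg_abs_le a, le_max_left |a| |b|]
    · linarith [le_abs_self b, le_max_right |a| |b|]
  set μ := volume.restrict (Icc (-r) r) with hμ
  set M' : ℝ≥0∞ := (⨆ f ∈ E, eLpNorm (lBound (f : ℝ × Eucl N → Eucl N) j) p μ) *
    μ univ ^ (1 - 1 / p.toReal) with hM'
  have hMtop : M' ≠ ∞ := ENNReal.mul_ne_top (hE j r hr0).ne (measure_univ_rpow_ne_top μ hp1)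
  refine ⟨M'.toNNReal, fun f hf => ?_⟩
  set B := Metric.closedBall (0 : Eucl N) j
  obtain ⟨Q, hQB, hQc, hQd⟩ :=
    (TopologicalSpace.IsSeparable.of_separableSpace B).exists_countable_dense_subset
  let F : ℝ × Eucl N → Eucl N := Subtype.val f
  set q : ℝ → ℝ≥0∞ := fun t => ⨆ x ∈ Q, ⨆ y ∈ Q, ⨆ _ : x ≠ y,
    ‖F (t, x) - F (t, y)‖ₑ / ‖x - y‖ₑ with hq
  have hqm : Measurable q := by
    refine Measurable.biSup Q hQc fun x _ => Measurable.biSup Q hQc fun y _ =>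
      Measurable.iSup fun _ => ?_
    exact ((f.2.1.measurable_left x).sub (f.2.1.measurable_left y)).enorm.div_const _
  have hqle : ∀ t, q t ≤ lBound F j t := fun t =>
    iSup₂_le fun x hx => iSup₂_le fun y hy => iSup_le fun hxy =>
      le_iSup₂_of_le x (hQB hx) (le_iSup₂_of_le y (hQB hy) (le_iSup_of_le hxy le_rfl))
  obtain ⟨l₀, -, -, hl₀⟩ := exists_lipschitz_of_mem_LC hp1 f.2
    (isCompact_closedBall (0 : Eucl N) (j : ℝ)) a b
  refine ⟨fun t => (q t).toNNReal, hqm.ennreal_toNNReal, ?_, ?_⟩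
  · rw [ENNReal.coe_toNNReal hMtop]
    have hmeas : AEStronglyMeasurable (fun t => ((q t).toNNReal : ℝ)) μ :=
      hqm.ennreal_toNNReal.coe_nnreal_real.aestronglyMeasurable
    have he : ∀ t, ‖((q t).toNNReal : ℝ)‖ₑ = ((q t).toNNReal : ℝ≥0∞) := fun t => by simp
    calc ∫⁻ t in Icc a b, ((q t).toNNReal : ℝ≥0∞)
        ≤ ∫⁻ t, ((q t).toNNReal : ℝ≥0∞) ∂μ := lintegral_mono_set hsub
      _ = ∫⁻ t, ‖((q t).toNNReal : ℝ)‖ₑ ∂μ := by simp only [he]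
      _ ≤ eLpNorm (fun t => ((q t).toNNReal : ℝ)) p μ * μ univ ^ (1 - 1 / p.toReal) :=
        lintegral_enorm_le_eLpNorm hp1 hmeas
      _ ≤ M' := by
        refine mul_le_mul_left ?_ _
        refine le_trans (eLpNorm_mono_enorm (g := lBound F j) fun t => ?_)
          (le_iSup₂ (f := fun (f : LC p N) (_ : f ∈ E) =>
            eLpNorm (lBound (f : ℝ × Eucl N → Eucl N) j) p μ) f hf)
        rw [he, enorm_eq_self]
        exact ENNReal.coe_toNNReal_le_self.trans (hqle t)
  · filter_upwards [hl₀] with t ht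
    have hqt : q t ≠ ∞ := by
      refine ne_top_of_le_ne_top (ENNReal.coe_ne_top (r := l₀ t)) ?_
      refine iSup₂_le fun x hx => iSup₂_le fun y hy => iSup_le fun hxy => ?_
      refine ENNReal.div_le_of_le_mul ?_
      rw [← edist_eq_enorm_sub, ← edist_eq_enorm_sub]
      exact ht (hQB hx) (hQB hy)
    have hlip : LipschitzOnWith (q t).toNNReal (fun x => F (t, x)) Q := by
      intro x hx y hy
      rcases eq_or_ne x y with rfl | hxy
      · simp
      · rw [ENNReal.coe_toNNReal hqt, edist_eq_enorm_sub, edist_eq_enorm_sub]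
        refine (ENNReal.div_le_iff (by simpa [sub_eq_zero] using hxy) enorm_ne_top).1 ?_
        exact le_iSup₂_of_le x hx (le_iSup₂_of_le y hy (le_iSup_of_le hxy le_rfl))
    have hcl : closure Q = B := (closure_minimal hQB Metric.isClosed_closedBall).antisymm hQd
    have := LipschitzOnWith.closure (s := Q) (by rw [hcl]; exact ht.continuousOn) hlip
    rwa [hcl] at this

end Bounds

/-! ### From a dense set to all curves in a ball -/

section Net

/-- The points of the net may lie outside the ball that it approximates; they are kept in the ball
of radius `j + 1`, where Lipschitz coefficients are available. -/
theorem exists_finset_net {D : Set (Eucl N)} (hD : Dense D) (j : ℕ) {η : ℝ≥0} (hη : 0 < η) :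
    ∃ S : Finset (Eucl N), ↑S ⊆ D ∧ ↑S ⊆ Metric.closedBall (0 : Eucl N) (j + 1 : ℕ) ∧
      ∀ x ∈ Metric.closedBall (0 : Eucl N) j, ∃ d ∈ S, edist x d ≤ η := by
  classical
  have hδ : (0 : ℝ) < min (η : ℝ) 1 := lt_min hη one_pos
  obtain ⟨S, hSD, hSf, hS⟩ := (isCompact_closedBall (0 : Eucl N) (j : ℝ)).elim_finite_subcover_image
    (b := D) (c := fun d => Metric.ball d (min (η : ℝ) 1)) (fun _ _ => Metric.isOpen_ball)
    fun x _ => by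
      obtain ⟨d, hd, hxd⟩ := hD.exists_dist_lt x hδ
      exact mem_biUnion hd hxd
  refine ⟨hSf.toFinset.filter (· ∈ Metric.closedBall (0 : Eucl N) (j + 1 : ℕ)), fun d hd => ?_,
    fun d hd => ?_, fun x hx => ?_⟩
  · simp only [Finset.coe_filter, Finite.mem_toFinset] at hd
    exact hSD hd.1
  · simp only [Finset.coe_filter] at hd
    exact hd.2
  · obtain ⟨d, hd, hxd⟩ := mem_iUnion₂.1 (hS hx)
    rw [Metric.mem_ball] at hxd
    refine ⟨d, ?_, ?_⟩
    · simp only [Finset.mem_filter, Finite.mem_toFinset]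
      refine ⟨hd, ?_⟩
      rw [Metric.mem_closedBall] at hx ⊢
      push_cast
      linarith [dist_triangle d x 0, dist_comm d x, hxd.trans_le (min_le_right _ _)]
    · rw [edist_nndist, ENNReal.coe_le_coe, ← NNReal.coe_le_coe, coe_nndist]
      exact hxd.le.trans (min_le_left _ _)

/-- The difference of two Lipschitz functions is controlled by its values on an `η`-net. -/
theorem enorm_sub_le_sum_net {X V : Type*} [PseudoEMetricSpace X] [NormedAddCommGroup V]
    {u v : X → V} {a b η : ℝ≥0} {B : Set X} (hu : LipschitzOnWith a u B)
    (hv : LipschitzOnWith b v B) {S : Finset X} (hS : ↑S ⊆ B) {x : X} (hx : x ∈ B)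
    (hxS : ∃ d ∈ S, edist x d ≤ η) :
    ‖u x - v x‖ₑ ≤ ∑ d ∈ S, ‖u d - v d‖ₑ + ((a : ℝ≥0∞) + b) * η := by
  obtain ⟨d, hd, hxd⟩ := hxS
  have e : u x - v x = (u d - v d) + ((u x - u d) - (v x - v d)) := by abel
  have h1 : ‖u x - u d‖ₑ ≤ a * η := by
    rw [← edist_eq_enorm_sub]
    exact (hu hx (hS hd)).trans (by gcongr)
  have h2 : ‖v x - v d‖ₑ ≤ b * η := by
    rw [← edist_eq_enorm_sub]
    exact (hv hx (hS hd)).trans (by gcongr)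
  calc ‖u x - v x‖ₑ ≤ ‖u d - v d‖ₑ + (‖u x - u d‖ₑ + ‖v x - v d‖ₑ) := by
        rw [e]
        exact (enorm_add_le _ _).trans (by gcongr; exact enorm_sub_le)
    _ ≤ ∑ d ∈ S, ‖u d - v d‖ₑ + ((a : ℝ≥0∞) + b) * η := by
        rw [add_mul]
        gcongr
        exact Finset.single_le_sum (f := fun d => ‖u d - v d‖ₑ) (fun _ _ => zero_le) hd

/-- Along a fixed curve `x`, convergence in `𝒯_D` within a set with bounded `l`-bounds gives
convergence of `f n (t, x t)` in `L¹`. -/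
theorem tendsto_lintegral_comp_of_topD (hp1 : 1 ≤ p) {D : Set (Eucl N)} (hD : Dense D)
    {E : Set (LC p N)} (hE : HasLpLocBoundedLBounds E) {f : ℕ → LC p N} {f₀ : LC p N}
    (hfE : ∀ n, f n ∈ E) (hf : Tendsto f atTop (@nhds _ (topD p D) f₀)) {a b : ℝ} {j : ℕ}
    {x : ℝ → Eucl N} (hx : MapsTo x (Icc a b) (Metric.closedBall 0 j)) :
    Tendsto (fun n => ∫⁻ t in Icc a b, ‖(f n : ℝ × Eucl N → Eucl N) (t, x t) -
      (f₀ : ℝ × Eucl N → Eucl N) (t, x t)‖ₑ) atTop (𝓝 0) := by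
  obtain ⟨I, hI⟩ := exists_subset_ratIcc a b
  obtain ⟨M, hM⟩ := hE.exists_lipschitz hp1 (j + 1) a b
  obtain ⟨l₀, hl₀m, hl₀i, hl₀⟩ := exists_lipschitz_of_mem_LC hp1 f₀.2
    (isCompact_closedBall (0 : Eucl N) ((j + 1 : ℕ) : ℝ)) a b
  have hpt : ∀ d ∈ D, Tendsto (fun n => ∫⁻ t in Icc a b, ‖(f n : ℝ × Eucl N → Eucl N) (t, d) -
      (f₀ : ℝ × Eucl N → Eucl N) (t, d)‖ₑ) atTop (𝓝 0) := fun d hd => by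
    have h1 := tendsto_seminorm_sub (i := (I, (⟨d, hd⟩ : D))) (by exact eLpNorm_zero') hf
    have h2 := tendsto_lintegral_enorm_of_tendsto_eLpNorm hp1 (fun n =>
      (((f n).2.1.measurable_left d).sub (f₀.2.1.measurable_left d)).aestronglyMeasurable) h1
    exact tendsto_of_tendsto_of_tendsto_of_le_of_le tendsto_const_nhds h2 (fun _ => zero_le)
      fun n => lintegral_mono_set hI
  rw [ENNReal.tendsto_nhds_zero]
  intro ε hε
  have hε2 : ε / 2 ≠ 0 := (ENNReal.half_pos hε.ne').ne'
  obtain ⟨η, hη, hηlt⟩ := ENNReal.exists_nnreal_pos_mul_lt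
    (ENNReal.add_ne_top.2 ⟨ENNReal.coe_ne_top (r := M), hl₀i.ne⟩) hε2
  obtain ⟨S, hSD, hSB, hS⟩ := exists_finset_net hD j hη
  have hsum := tendsto_finsetSum S fun d hd => hpt d (hSD hd)
  rw [Finset.sum_const_zero] at hsum
  filter_upwards [ENNReal.tendsto_nhds_zero.1 hsum (ε / 2) (ENNReal.half_pos hε.ne')] with n hn
  obtain ⟨l, hlm, hli, hl⟩ := hM (f n) (hfE n)
  have hmeas : ∀ d, Measurable fun t => ‖(f n : ℝ × Eucl N → Eucl N) (t, d) -
      (f₀ : ℝ × Eucl N → Eucl N) (t, d)‖ₑ := fun d =>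
    (((f n).2.1.measurable_left d).sub (f₀.2.1.measurable_left d)).enorm
  have hjj : Metric.closedBall (0 : Eucl N) j ⊆ Metric.closedBall 0 (j + 1 : ℕ) :=
    Metric.closedBall_subset_closedBall (by push_cast; linarith)
  calc ∫⁻ t in Icc a b, ‖(f n : ℝ × Eucl N → Eucl N) (t, x t) -
        (f₀ : ℝ × Eucl N → Eucl N) (t, x t)‖ₑ
      ≤ ∫⁻ t in Icc a b, (∑ d ∈ S, ‖(f n : ℝ × Eucl N → Eucl N) (t, d) -
        (f₀ : ℝ × Eucl N → Eucl N) (t, d)‖ₑ + ((l t : ℝ≥0∞) + l₀ t) * η) := by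
        refine lintegral_mono_ae ?_
        filter_upwards [hl, hl₀, ae_restrict_mem measurableSet_Icc] with t h1 h2 ht
        exact enorm_sub_le_sum_net h1 h2 hSB (hjj (hx ht)) (hS _ (hx ht))
    _ = ∑ d ∈ S, (∫⁻ t in Icc a b, ‖(f n : ℝ × Eucl N → Eucl N) (t, d) -
        (f₀ : ℝ × Eucl N → Eucl N) (t, d)‖ₑ) +
        ((∫⁻ t in Icc a b, l t) + ∫⁻ t in Icc a b, l₀ t) * η := by
        rw [lintegral_add_left (Finset.measurable_fun_sum S fun d _ => hmeas d),
          lintegral_finsetSum S fun d _ => hmeas d,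
          lintegral_mul_const _ (by fun_prop),
          lintegral_add_left hlm.coe_nnreal_ennreal]
    _ ≤ ε / 2 + ε / 2 := by
        refine add_le_add hn (le_trans ?_ hηlt.le)
        rw [mul_comm]
        gcongr
    _ = ε := ENNReal.add_halves ε

/-- Total boundedness for one seminorm makes the functions `f (·, d)`, `f ∈ C`, equi-integrable. -/
theorem eventually_setLIntegral_le_of_isCompact (hp1 : 1 ≤ p) {D : Set (Eucl N)}
    {C : Set (LC p N)} (hC : @IsCompact _ (topD p D) C) (I : NonemptyInterval ℚ) {d : Eucl N}
    (hd : d ∈ D) {ε : ℝ≥0∞} (hε : 0 < ε) :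
    ∀ᶠ δ in 𝓝[>] (0 : ℝ≥0∞), ∀ f ∈ C, ∀ A ⊆ ratIcc I, volume A < δ →
      ∫⁻ t in A, ‖(f : ℝ × Eucl N → Eucl N) (t, d)‖ₑ ≤ ε := by
  set μ := volume.restrict (ratIcc I)
  set c := μ univ ^ (1 - 1 / p.toReal)
  have hε2 : 0 < ε / 2 := ENNReal.half_pos hε.ne'
  obtain ⟨e, he, helt⟩ := ENNReal.exists_nnreal_pos_mul_lt (measure_univ_rpow_ne_top μ hp1)
    hε2.ne'
  obtain ⟨G, -, hG⟩ := @IsCompact.elim_nhds_subcover _ (topD p D) C hC _ fun g _ =>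
    ball_mem_nhds_seminormTopology (LC p N) _ (i := (I, (⟨d, hd⟩ : D))) (by exact eLpNorm_zero')
      g (ε := e) (by exact_mod_cast he)
  have hsmall : ∀ g ∈ G, ∀ᶠ δ in 𝓝[>] (0 : ℝ≥0∞), ∀ A ⊆ ratIcc I, volume A < δ →
      ∫⁻ t in A, ‖(g : ℝ × Eucl N → Eucl N) (t, d)‖ₑ ≤ ε / 2 := fun g _ => by
    have hi : IntegrableOn (fun t => (g : ℝ × Eucl N → Eucl N) (t, d)) (ratIcc I) :=
      g.2.1.integrableOn_comp hp1 continuousOn_const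
    obtain ⟨δ, hδ, h⟩ := exists_pos_setLIntegral_lt_of_measure_lt hi.2.ne hε2.ne'
    filter_upwards [Ioo_mem_nhdsGT hδ] with δ' hδ' A hA hlt
    have := h A ((Measure.restrict_apply_le _ _).trans_lt (hlt.trans hδ'.2))
    rw [Measure.restrict_restrict_of_subset hA] at this
    exact this.le
  filter_upwards [(eventually_all_finset G).2 hsmall] with δ hδ f hf A hA hlt
  obtain ⟨g, hg, hfg⟩ := mem_iUnion₂.1 (hG hf)
  have hfg' : eLpNorm (fun t => (f : ℝ × Eucl N → Eucl N) (t, d) -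
    (g : ℝ × Eucl N → Eucl N) (t, d)) p μ < e := hfg
  have hm : Measurable fun t => (f : ℝ × Eucl N → Eucl N) (t, d) -
    (g : ℝ × Eucl N → Eucl N) (t, d) := (f.2.1.measurable_left d).sub (g.2.1.measurable_left d)
  calc ∫⁻ t in A, ‖(f : ℝ × Eucl N → Eucl N) (t, d)‖ₑ
      ≤ ∫⁻ t in A, (‖(g : ℝ × Eucl N → Eucl N) (t, d)‖ₑ + ‖(f : ℝ × Eucl N → Eucl N) (t, d) -
        (g : ℝ × Eucl N → Eucl N) (t, d)‖ₑ) := by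
        refine lintegral_mono fun t => ?_
        have := enorm_add_le ((g : ℝ × Eucl N → Eucl N) (t, d))
          ((f : ℝ × Eucl N → Eucl N) (t, d) - (g : ℝ × Eucl N → Eucl N) (t, d))
        rwa [add_sub_cancel] at this
    _ = (∫⁻ t in A, ‖(g : ℝ × Eucl N → Eucl N) (t, d)‖ₑ) + ∫⁻ t in A,
        ‖(f : ℝ × Eucl N → Eucl N) (t, d) - (g : ℝ × Eucl N → Eucl N) (t, d)‖ₑ :=
        lintegral_add_left (g.2.1.measurable_left d).enorm _
    _ ≤ ε / 2 + ε / 2 := by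
        refine add_le_add (hδ g hg A hA hlt) ?_
        refine (lintegral_mono_set hA).trans ((lintegral_enorm_le_eLpNorm hp1
          hm.aestronglyMeasurable).trans (le_trans ?_ helt.le))
        gcongr
    _ = ε := ENNReal.add_halves ε

/-- The curves along which members of a `𝒯_D`-compact set with bounded `l`-bounds are evaluated
may vary: the integrals over small sets are uniformly small. For `p = 1` the Lipschitz coefficients
are not equi-integrable, so the mesh of the net is chosen before `δ`. -/
theorem exists_setLIntegral_comp_le_of_isCompact (hp1 : 1 ≤ p) {D : Set (Eucl N)} (hD : Dense D)
    {E C : Set (LC p N)} (hE : HasLpLocBoundedLBounds E) (hCE : C ⊆ E)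
    (hC : @IsCompact _ (topD p D) C) (I : NonemptyInterval ℚ) (j : ℕ) {ε : ℝ≥0∞} (hε : 0 < ε) :
    ∃ δ > (0 : ℝ≥0∞), ∀ f ∈ C, ∀ A ⊆ ratIcc I, MeasurableSet A → volume A < δ →
      ∀ x : ℝ → Eucl N, MapsTo x A (Metric.closedBall 0 j) →
      ∫⁻ t in A, ‖(f : ℝ × Eucl N → Eucl N) (t, x t)‖ₑ ≤ ε := by
  have hε2 : 0 < ε / 2 := ENNReal.half_pos hε.ne'
  obtain ⟨M, hM⟩ := hE.exists_lipschitz hp1 (j + 1) I.fst I.snd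
  obtain ⟨η, hη, hηlt⟩ := ENNReal.exists_nnreal_pos_mul_lt (ENNReal.coe_ne_top (r := M)) hε2.ne'
  obtain ⟨S, hSD, hSB, hS⟩ := exists_finset_net hD j hη
  obtain ⟨e, he, helt⟩ := ENNReal.exists_nnreal_pos_mul_lt (ENNReal.natCast_ne_top S.card) hε2.ne'
  obtain ⟨δ, hδ, hδ0⟩ := (((eventually_all_finset S).2 fun d hd =>
    eventually_setLIntegral_le_of_isCompact hp1 hC I (hSD hd)
      (ε := e) (by exact_mod_cast he)).and self_mem_nhdsWithin).exists
  refine ⟨δ, hδ0, fun f hf A hA hAm hlt x hx => ?_⟩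
  obtain ⟨l, hlm, hli, hl⟩ := hM f (hCE hf)
  have hjj : Metric.closedBall (0 : Eucl N) j ⊆ Metric.closedBall 0 (j + 1 : ℕ) :=
    Metric.closedBall_subset_closedBall (by push_cast; linarith)
  have hmeas : ∀ d, Measurable fun t => ‖(f : ℝ × Eucl N → Eucl N) (t, d)‖ₑ := fun d =>
    (f.2.1.measurable_left d).enorm
  calc ∫⁻ t in A, ‖(f : ℝ × Eucl N → Eucl N) (t, x t)‖ₑ
      ≤ ∫⁻ t in A, (∑ d ∈ S, ‖(f : ℝ × Eucl N → Eucl N) (t, d)‖ₑ + (l t : ℝ≥0∞) * η) := by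
        refine lintegral_mono_ae ?_
        filter_upwards [ae_restrict_of_ae_restrict_of_subset hA hl, ae_restrict_mem hAm]
          with t h1 ht
        simpa using enorm_sub_le_sum_net h1 (LipschitzWith.const (0 : Eucl N)).lipschitzOnWith hSB
          (hjj (hx ht)) (hS _ (hx ht))
    _ = ∑ d ∈ S, (∫⁻ t in A, ‖(f : ℝ × Eucl N → Eucl N) (t, d)‖ₑ) + (∫⁻ t in A, l t) * η := by
        rw [lintegral_add_left (Finset.measurable_fun_sum S fun d _ => hmeas d),
          lintegral_finsetSum S fun d _ => hmeas d,
          lintegral_mul_const _ hlm.coe_nnreal_ennreal]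
    _ ≤ ε / 2 + ε / 2 := by
        refine add_le_add ?_ ?_
        · refine (Finset.sum_le_card_nsmul S _ (e : ℝ≥0∞)
            fun d hd => hδ d hd f hf A hA hlt).trans ?_
          rw [nsmul_eq_mul, mul_comm]
          exact helt.le
        · refine le_trans ?_ hηlt.le
          rw [mul_comm]
          gcongr
          exact (lintegral_mono_set hA).trans hli
    _ = ε := ENNReal.add_halves ε

end Net

/-! ### Equicontinuity and the optimal modulus of continuity -/

section Modulus

theorem IsSolutionOn.edist_le {W : Type*} [NormedAddCommGroup W] [NormedSpace ℝ W]
    {g : ℝ × W → W} {J : Set ℝ} {w : ℝ → W} (h : IsSolutionOn g J w) {s t : ℝ} (hs : s ∈ J)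
    (ht : t ∈ J) : edist (w s) (w t) ≤ ∫⁻ u in uIoc s t, ‖g (u, w u)‖ₑ := by
  rw [edist_comm, edist_eq_enorm_sub, (h.2 s hs t ht).2, add_sub_cancel_left]
  refine le_trans (le_of_eq ?_) (enorm_integral_le_lintegral_enorm _)
  rw [← ofReal_norm, intervalIntegral.norm_intervalIntegral_eq, ofReal_norm]

/-- The solutions of the equations with right-hand sides in a `𝒯_D`-compact set with bounded
`l`-bounds, with values in a fixed ball, are equicontinuous. -/
theorem exists_dist_lt_of_mem_solSet (hp1 : 1 ≤ p) {D : Set (Eucl N)} (hD : Dense D)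
    {E C : Set (LC p N)} (hE : HasLpLocBoundedLBounds E) (hCE : C ⊆ E)
    (hC : @IsCompact _ (topD p D) C) (I : NonemptyInterval ℚ) (j : ℕ) {ε : ℝ} (hε : 0 < ε) :
    ∃ δ > 0, ∀ z ∈ solSet C I j, ∀ s ∈ z.1, ∀ t ∈ z.1, dist s t < δ →
      dist (z.2 s) (z.2 t) < ε := by
  obtain ⟨δ, hδ, h⟩ := exists_setLIntegral_comp_le_of_isCompact hp1 hD hE hCE hC I j
    (ENNReal.ofReal_pos.2 (half_pos hε))
  obtain ⟨r, hr, hrδ⟩ := ENNReal.lt_iff_exists_nnreal_btwn.1 hδ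
  refine ⟨r, by exact_mod_cast hr, ?_⟩
  rintro ⟨J, x⟩ ⟨hJI, hxB, f, hf, hx⟩ s hs t ht hst
  have hsub : uIoc s t ⊆ J := uIoc_subset_uIcc.trans (hx.1.uIcc_subset hs ht)
  have hvol : volume (uIoc s t) < δ := by
    rw [Real.volume_uIoc, ← Real.dist_eq, dist_comm]
    refine lt_of_le_of_lt (ENNReal.ofReal_le_of_le_toReal ?_) hrδ
    simpa using hst.le
  have := (hx.edist_le hs ht).trans
    (h f hf _ (hsub.trans hJI) measurableSet_uIoc hvol x (hxB.mono_left hsub))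
  rw [edist_dist, ENNReal.ofReal_le_ofReal_iff (half_pos hε).le] at this
  exact this.trans_lt (half_lt_self hε)

variable {C : Set (LC p N)}

theorem nndist_le_solModulus {I : NonemptyInterval ℚ} {j : ℕ} {z : Set ℝ × (ℝ → Eucl N)}
    (hz : z ∈ solSet C I j) {s t : ℝ} (hs : s ∈ z.1) (ht : t ∈ z.1) {r : ℝ≥0}
    (hr : nndist s t ≤ r) : nndist (z.2 s) (z.2 t) ≤ solModulus C I j r := by
  refine le_csSup ⟨2 * j, ?_⟩ ⟨z, hz, s, hs, t, ht, hr, rfl⟩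
  rintro _ ⟨z, hz, s, hs, t, ht, -, rfl⟩
  rw [← NNReal.coe_le_coe, coe_nndist]
  push_cast
  have h1 := Metric.mem_closedBall.1 (hz.2.1 hs)
  have h2 := Metric.mem_closedBall.1 (hz.2.1 ht)
  linarith [dist_triangle_right (z.2 s) (z.2 t) 0]

theorem solModulus_le {I : NonemptyInterval ℚ} {j : ℕ} {r c : ℝ≥0}
    (h : ∀ z ∈ solSet C I j, ∀ s ∈ z.1, ∀ t ∈ z.1, s ≤ t → nndist s t ≤ r →
      nndist (z.2 s) (z.2 t) ≤ c) : solModulus C I j r ≤ c := by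
  refine csSup_le' ?_
  rintro _ ⟨z, hz, s, hs, t, ht, hst, rfl⟩
  rcases le_total s t with hle | hle
  · exact h z hz s hs t ht hle hst
  · rw [nndist_comm]
    exact h z hz t ht s hs hle (by rwa [nndist_comm])

/-- Subadditivity: two points of an interval at distance at most `r₁ + r₂` are joined through an
intermediate point of that interval. -/
theorem solModulus_add_le (I : NonemptyInterval ℚ) (j : ℕ) (r₁ r₂ : ℝ≥0) :
    solModulus C I j (r₁ + r₂) ≤ solModulus C I j r₁ + solModulus C I j r₂ := by
  refine solModulus_le fun z hz s hs t ht hst hd => ?_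
  rw [← NNReal.coe_le_coe, coe_nndist, Real.dist_eq, abs_sub_comm, abs_of_nonneg (by linarith)]
    at hd
  push_cast at hd
  have hr₁ := r₁.coe_nonneg
  have hsu : s ≤ min t (s + r₁) := le_min hst (by linarith)
  have hut : min t (s + r₁) ≤ t := min_le_left _ _
  have hu : min t (s + r₁) ∈ z.1 := by
    obtain ⟨-, -, f, -, hx⟩ := hz
    exact hx.1.out hs ht ⟨hsu, hut⟩
  refine (nndist_triangle _ (z.2 (min t (s + r₁))) _).trans
    (add_le_add (nndist_le_solModulus hz hs hu ?_) (nndist_le_solModulus hz hu ht ?_))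
  · rw [← NNReal.coe_le_coe, coe_nndist, Real.dist_eq, abs_sub_comm,
      abs_of_nonneg (by linarith)]
    linarith [min_le_right t (s + r₁)]
  · rw [← NNReal.coe_le_coe, coe_nndist, Real.dist_eq, abs_sub_comm,
      abs_of_nonneg (by linarith)]
    rcases min_choice t (s + r₁) with h | h <;> rw [h]
    · simp
    · linarith

theorem solModulus_mono (I : NonemptyInterval ℚ) (j : ℕ) : Monotone (solModulus C I j) :=
  fun _ _ h => solModulus_le fun _ hz _ hs _ ht _ hd => nndist_le_solModulus hz hs ht (hd.trans h)

theorem isSuitable_solModulus (h : ∀ (I : NonemptyInterval ℚ) (j : ℕ), ∀ ε > 0, ∃ δ > 0,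
    ∀ z ∈ solSet C I j, ∀ s ∈ z.1, ∀ t ∈ z.1, dist s t < δ → dist (z.2 s) (z.2 t) < ε) :
    IsSuitable (solModulus C) where
  monotone := solModulus_mono
  continuous I j := by
    rw [Metric.continuous_iff]
    intro r ε hε
    obtain ⟨δ, hδ, hzδ⟩ := h I j (ε / 2) (half_pos hε)
    refine ⟨δ, hδ, fun r' hr' => ?_⟩
    have hsmall : (solModulus C I j (nndist r' r) : ℝ) ≤ ε / 2 := by
      have : solModulus C I j (nndist r' r) ≤ (ε / 2).toNNReal :=
        solModulus_le fun z hz s hs t ht _ hd => by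
          rw [← NNReal.coe_le_coe, Real.coe_toNNReal _ (half_pos hε).le, coe_nndist]
          refine (hzδ z hz s hs t ht (lt_of_le_of_lt ?_ hr')).le
          exact_mod_cast hd
      have h2 := NNReal.coe_le_coe.2 this
      rwa [Real.coe_toNNReal _ (half_pos hε).le] at h2
    have hstep : ∀ a b : ℝ≥0, (solModulus C I j a : ℝ) ≤
        solModulus C I j b + solModulus C I j (nndist a b) := fun a b => by
      have hab : a ≤ b + nndist a b := by
        rw [← NNReal.coe_le_coe, NNReal.coe_add, coe_nndist, NNReal.dist_eq]
        linarith [le_abs_self ((a : ℝ) - b)]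
      exact_mod_cast (solModulus_mono I j hab).trans (solModulus_add_le I j _ _)
    have h1 := hstep r' r
    have h2 := hstep r r'
    rw [nndist_comm r r'] at h2
    rw [NNReal.dist_eq, abs_lt]
    constructor <;> linarith
  zero I j := by
    refine le_antisymm (solModulus_le fun z _ s _ t _ _ hd => ?_) zero_le
    rw [nndist_eq_zero.1 (le_antisymm hd zero_le), nndist_self]
  le I₁ I₂ j₁ j₂ hI hj r := by
    refine solModulus_le fun z hz s hs t ht _ hd => nndist_le_solModulus (?_ : z ∈ _) hs ht hd
    exact ⟨hz.1.trans hI, hz.2.1.mono_right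
      (Metric.closedBall_subset_closedBall (by exact_mod_cast hj)), hz.2.2⟩

end Modulus

/-! ### Radial truncation -/

section Truncation

variable {V : Type*} [NormedAddCommGroup V] [NormedSpace ℝ V]

/-- The radial retraction of a normed space onto the closed ball of radius `R > 0`. -/
noncomputable def radialClamp (R : ℝ) (x : V) : V := (R / max R ‖x‖) • x

theorem norm_radialClamp_le {R : ℝ} (hR : 0 < R) (x : V) : ‖radialClamp R x‖ ≤ R := by
  have hm : 0 < max R ‖x‖ := lt_max_of_lt_left hR
  rw [radialClamp, norm_smul, Real.norm_of_nonneg (by positivity), div_mul_eq_mul_div,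
    div_le_iff₀ hm]
  exact mul_le_mul_of_nonneg_left (le_max_right _ _) hR.le

theorem radialClamp_of_norm_le {R : ℝ} (hR : 0 < R) {x : V} (hx : ‖x‖ ≤ R) :
    radialClamp R x = x := by
  rw [radialClamp, max_eq_left hx, div_self hR.ne', one_smul]

theorem norm_radialClamp_sub_le {R : ℝ} (hR : 0 < R) (x y : V) :
    ‖radialClamp R x - radialClamp R y‖ ≤ 2 * ‖x - y‖ := by
  have ha : 0 < max R ‖x‖ := lt_max_of_lt_left hR
  have hb : 0 < max R ‖y‖ := lt_max_of_lt_left hR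
  set a := max R ‖x‖
  set b := max R ‖y‖
  have e : radialClamp R x - radialClamp R y =
      (R / a) • ((x - y) + ((b - a) / b) • y) := by
    simp only [radialClamp]
    rw [smul_add, smul_smul, smul_sub, sub_add, ← sub_smul]
    congr 2
    simp only [a, b] at ha hb ⊢
    field_simp
    ring
  have hab : |b - a| ≤ ‖x - y‖ := by
    have h1 : |max ‖y‖ R - max ‖x‖ R| ≤ |‖y‖ - ‖x‖| := abs_max_sub_max_le_abs _ _ _
    rw [max_comm ‖y‖, max_comm ‖x‖] at h1
    rw [norm_sub_rev x y]
    exact h1.trans (abs_norm_sub_norm_le y x)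
  have h2 : ‖((b - a) / b) • y‖ ≤ ‖x - y‖ := by
    rw [norm_smul, norm_div, Real.norm_eq_abs, Real.norm_of_nonneg hb.le, div_mul_eq_mul_div,
      div_le_iff₀ hb]
    exact mul_le_mul hab (le_max_right _ _) (norm_nonneg _) (norm_nonneg _)
  rw [e, norm_smul, Real.norm_of_nonneg (by positivity)]
  calc R / a * ‖(x - y) + ((b - a) / b) • y‖ ≤ 1 * (‖x - y‖ + ‖x - y‖) := by
        gcongr
        · exact (div_le_one ha).2 (le_max_left _ _)
        · exact (norm_add_le _ _).trans (by gcongr)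
    _ = 2 * ‖x - y‖ := by ring

theorem continuous_radialClamp {R : ℝ} (hR : 0 < R) : Continuous (radialClamp R : V → V) :=
  (LipschitzWith.of_dist_le_mul (K := 2) fun x y => by
    rw [dist_eq_norm, dist_eq_norm]
    exact norm_radialClamp_sub_le hR x y).continuous

end Truncation

/-! ### Uniqueness and continuous dependence for Lipschitz Caratheodory functions -/

section ContinuousDependence

theorem integrable_indicator_coe {l : ℝ → ℝ≥0} (hl : Measurable l) {a b : ℝ}
    (hi : ∫⁻ t in Icc a b, l t ≠ ∞) :
    Integrable ((Icc a b).indicator fun t => (l t : ℝ)) := by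
  rw [integrable_indicator_iff measurableSet_Icc]
  refine ⟨hl.coe_nnreal_real.aestronglyMeasurable, ?_⟩
  simpa [HasFiniteIntegral] using hi.lt_top

theorem integral_indicator_coe_le {l : ℝ → ℝ≥0} (hl : Measurable l) {a b : ℝ} {M : ℝ≥0}
    (hi : ∫⁻ t in Icc a b, l t ≤ M) :
    ∫ t, (Icc a b).indicator (fun t => (l t : ℝ)) t ≤ M := by
  rw [integral_indicator measurableSet_Icc, integral_eq_lintegral_of_nonneg_ae
    (Eventually.of_forall fun t => (l t).coe_nonneg) hl.coe_nnreal_real.aestronglyMeasurable]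
  refine ENNReal.toReal_le_of_le_ofReal M.coe_nonneg ?_
  simpa using hi

theorem IsSolutionOn.exists_norm_le {W : Type*} [NormedAddCommGroup W] [NormedSpace ℝ W]
    {g : ℝ × W → W} {T₁ T₂ : ℝ} {w : ℝ → W} (h : IsSolutionOn g (Icc T₁ T₂) w) :
    ∃ R, ∀ t ∈ Icc T₁ T₂, ‖w t‖ ≤ R :=
  isCompact_Icc.exists_bound_of_continuousOn h.continuousOn

/-- Uniqueness of the solutions of the Cauchy problem for a Lipschitz Caratheodory function. -/
theorem IsSolutionOn.eqOn_of_mem_LC (hp1 : 1 ≤ p) {f : ℝ × Eucl N → Eucl N} (hf : f ∈ LC p N)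
    {T₁ T₂ : ℝ} (hT : (0 : ℝ) ∈ Icc T₁ T₂) {u v : ℝ → Eucl N} (hu : IsSolutionOn f (Icc T₁ T₂) u)
    (hv : IsSolutionOn f (Icc T₁ T₂) v) (h0 : u 0 = v 0) : EqOn u v (Icc T₁ T₂) := by
  obtain ⟨R, hR⟩ := hu.exists_norm_le
  obtain ⟨R', hR'⟩ := hv.exists_norm_le
  obtain ⟨l, hlm, hli, hl⟩ := exists_lipschitz_of_mem_LC hp1 hf
    (isCompact_closedBall (0 : Eucl N) (max R R')) T₁ T₂
  intro t ht
  have := hu.norm_sub_le (k := fun _ => 0) hT hv (integrable_indicator_coe hlm hli.ne)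
    (fun t => indicator_nonneg (fun _ _ => NNReal.coe_nonneg _) t) integrableOn_zero
    (fun _ => le_rfl) (by
      filter_upwards [hl, ae_restrict_mem measurableSet_Icc] with s hs hsm
      rw [indicator_of_mem hsm, add_zero, ← dist_eq_norm, ← dist_eq_norm]
      exact hs.dist_le_mul _ (mem_closedBall_zero_iff.2 ((hR s hsm).trans (le_max_left _ _)))
        _ (mem_closedBall_zero_iff.2 ((hR' s hsm).trans (le_max_right _ _)))) t ht
  simp only [h0, sub_self, norm_zero, integral_zero, add_zero, mul_zero, zero_mul] at this
  exact sub_eq_zero.1 (norm_le_zero_iff.1 this)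

/-- For large `n` there is a solution for `f n` close to a given solution for the limit `f₀`. The
right-hand side `f n` is first truncated by a retraction onto a ball, so as to have global
solutions; Gronwall's inequality shows that these stay where the truncation is inactive. -/
theorem eventually_exists_isSolutionOn (hp1 : 1 ≤ p) {D : Set (Eucl N)} (hD : Dense D)
    {E : Set (LC p N)} (hE : HasLpLocBoundedLBounds E) {f : ℕ → LC p N} {f₀ : LC p N}
    {a : ℕ → Eucl N} {T₁ T₂ : ℝ} {x₀ : ℝ → Eucl N}
    (hfE : ∀ n, f n ∈ E) (hf : Tendsto f atTop (@nhds _ (topD p D) f₀))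
    (ha : Tendsto a atTop (𝓝 (x₀ 0))) (hT : (0 : ℝ) ∈ Icc T₁ T₂)
    (hx₀ : IsSolutionOn (f₀ : ℝ × Eucl N → Eucl N) (Icc T₁ T₂) x₀) {ε : ℝ} (hε : 0 < ε) :
    ∀ᶠ n in atTop, ∃ x, IsSolutionOn (f n : ℝ × Eucl N → Eucl N) (Icc T₁ T₂) x ∧ x 0 = a n ∧
      ∀ t ∈ Icc T₁ T₂, ‖x t - x₀ t‖ < ε := by
  obtain ⟨R, hR⟩ := hx₀.exists_norm_le
  obtain ⟨j, hj⟩ := exists_nat_ge (max R 0 + 1)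
  have hjR : R + 1 ≤ j := by linarith [le_max_left R 0]
  have hj0 : (0 : ℝ) < j := by linarith [le_max_right R 0]
  have hx₀j : ∀ t ∈ Icc T₁ T₂, ‖x₀ t‖ ≤ j := fun t ht => by linarith [hR t ht]
  obtain ⟨M, hM⟩ := hE.exists_lipschitz hp1 j T₁ T₂
  have hconv := tendsto_lintegral_comp_of_topD hp1 hD hE hfE hf
    (fun t ht => mem_closedBall_zero_iff.2 (hx₀j t ht))
  have hbound : Tendsto (fun n => 2 * (‖a n - x₀ 0‖ + (∫⁻ t in Icc T₁ T₂,
      ‖(f n : ℝ × Eucl N → Eucl N) (t, x₀ t) -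
        (f₀ : ℝ × Eucl N → Eucl N) (t, x₀ t)‖ₑ).toReal) * Real.exp (4 * (2 * M)))
      atTop (𝓝 0) := by
    have h1 := (ENNReal.tendsto_toReal ENNReal.zero_ne_top).comp hconv
    have h2 := ((tendsto_iff_norm_sub_tendsto_zero.1 ha).add h1).const_mul 2
    simpa using h2.mul_const (Real.exp (4 * (2 * M)))
  filter_upwards [hbound.eventually_lt_const (lt_min hε one_pos)] with n hn
  obtain ⟨l, hlm, hli, hl⟩ := hM (f n) (hfE n)
  set fn : ℝ × Eucl N → Eucl N := (f n).1 with hfn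
  set f₀' : ℝ × Eucl N → Eucl N := f₀.1 with hf₀'
  set L : ℝ → ℝ := fun t => 2 * (Icc T₁ T₂).indicator (fun t => (l t : ℝ)) t with hL
  have hLi : Integrable L :=
    (integrable_indicator_coe hlm (ne_top_of_le_ne_top ENNReal.coe_ne_top hli)).const_mul 2
  have hL0 : ∀ t, 0 ≤ L t := fun t =>
    mul_nonneg zero_le_two (indicator_nonneg (fun _ _ => NNReal.coe_nonneg _) t)
  have hLM : ∫ t, L t ≤ 2 * M := by
    rw [hL, integral_const_mul]
    exact mul_le_mul_of_nonneg_left (integral_indicator_coe_le hlm hli) zero_le_two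
  have hlip : ∀ᵐ t ∂volume.restrict (Icc T₁ T₂), ∀ x y : Eucl N,
      ‖fn (t, radialClamp j x) - fn (t, radialClamp j y)‖ ≤ L t * ‖x - y‖ := by
    filter_upwards [hl, ae_restrict_mem measurableSet_Icc] with t ht htm x y
    have h1 := ht.dist_le_mul _ (mem_closedBall_zero_iff.2 (norm_radialClamp_le hj0 x))
      _ (mem_closedBall_zero_iff.2 (norm_radialClamp_le hj0 y))
    rw [dist_eq_norm, dist_eq_norm] at h1
    have h2 := mul_le_mul_of_nonneg_left (norm_radialClamp_sub_le hj0 x y) (l t).coe_nonneg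
    simp only [hL, indicator_of_mem htm]
    linarith
  obtain ⟨x, hx, hx0⟩ := exists_isSolutionOn_of_lipschitz
    (g := fun q : ℝ × Eucl N => fn (q.1, radialClamp j q.2)) hT hLi hL0
    (fun w hw => (f n).2.1.integrableOn_comp hp1
      ((continuous_radialClamp hj0).comp hw).continuousOn) hlip (a n)
  have hki : IntegrableOn (fun t => fn (t, x₀ t) - f₀' (t, x₀ t)) (Icc T₁ T₂) :=
    ((f n).2.1.integrableOn_comp hp1 hx₀.continuousOn).sub
      (f₀.2.1.integrableOn_comp hp1 hx₀.continuousOn)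
  have hclose : ∀ t ∈ Icc T₁ T₂, ‖x t - x₀ t‖ < min ε 1 := fun t ht => by
    have := hx.norm_sub_le (k := fun t => ‖fn (t, x₀ t) - f₀' (t, x₀ t)‖) hT hx₀ hLi hL0
      hki.norm (fun _ => norm_nonneg _) (by
        filter_upwards [hlip, ae_restrict_mem measurableSet_Icc] with s hs hsm
        have h1 := hs (x s) (x₀ s)
        rw [radialClamp_of_norm_le hj0 (hx₀j s hsm)] at h1
        refine (norm_sub_le_norm_sub_add_norm_sub _ (fn (s, x₀ s)) _).trans ?_
        gcongr) t ht
    rw [hx0, integral_norm_eq_lintegral_enorm hki.aestronglyMeasurable] at this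
    refine (this.trans ?_).trans_lt hn
    gcongr
  refine ⟨x, hx.congr (fun t ht => ?_) (fun _ _ => rfl), hx0, fun t ht =>
    (hclose t ht).trans_le (min_le_left _ _)⟩
  have h1 := (hclose t ht).trans_le (min_le_right _ _)
  have h2 : ‖x t‖ ≤ j := by
    have := norm_add_le (x t - x₀ t) (x₀ t)
    rw [sub_add_cancel] at this
    linarith [hR t ht]
  simp only [radialClamp_of_norm_le hj0 h2, hfn]

/-- Continuous dependence on a compact interval containing the initial time. -/
theorem tendstoUniformlyOn_of_isSolutionOn (hp1 : 1 ≤ p) {D : Set (Eucl N)} (hD : Dense D)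
    {E : Set (LC p N)} (hE : HasLpLocBoundedLBounds E) {f : ℕ → LC p N} {f₀ : LC p N}
    {T₁ T₂ : ℝ} {x : ℕ → ℝ → Eucl N} {x₀ : ℝ → Eucl N}
    (hfE : ∀ n, f n ∈ E) (hf : Tendsto f atTop (@nhds _ (topD p D) f₀))
    (ha : Tendsto (fun n => x n 0) atTop (𝓝 (x₀ 0))) (hT : (0 : ℝ) ∈ Icc T₁ T₂)
    (hx₀ : IsSolutionOn (f₀ : ℝ × Eucl N → Eucl N) (Icc T₁ T₂) x₀)
    (hx : ∀ᶠ n in atTop, IsSolutionOn (f n : ℝ × Eucl N → Eucl N) (Icc T₁ T₂) (x n)) :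
    TendstoUniformlyOn x x₀ atTop (Icc T₁ T₂) := by
  rw [Metric.tendstoUniformlyOn_iff]
  intro ε hε
  filter_upwards [hx, eventually_exists_isSolutionOn hp1 hD hE hfE hf ha hT hx₀ hε]
    with n hn ⟨y, hy, hy0, hyε⟩ t ht
  rw [dist_comm, dist_eq_norm, hn.eqOn_of_mem_LC hp1 (f n).2 hT hy hy0.symm ht]
  exact hyε t ht

theorem IsMaxSolution.isSolutionOn {W : Type*} [NormedAddCommGroup W] [NormedSpace ℝ W]
    {g : ℝ × W → W} {w₀ : W} {w : ℝ → W} (h : IsMaxSolution g w₀ w) {T₁ T₂ : ℝ}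
    (hT : Icc T₁ T₂ ⊆ maxInterval g w₀) : IsSolutionOn g (Icc T₁ T₂) w :=
  h.1.mono ordConnected_Icc hT

end ContinuousDependence

/-! ### Convergence along curves with a given modulus of continuity -/

section ModSet

variable {θ : NonemptyInterval ℚ → ℕ → ℝ≥0 → ℝ≥0} {I : NonemptyInterval ℚ} {j : ℕ}

/-- A solution on `[T₁, T₂]`, continued by constants, has the modulus of continuity `solModulus`
on the whole of `I`. -/
theorem comp_projIcc_mem_modSet {C : Set (LC p N)} {T₁ T₂ : ℝ}
    (hle : T₁ ≤ T₂) {x : ℝ → Eucl N} (hx : (Icc T₁ T₂, x) ∈ solSet C I j) :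
    (fun t => x (projIcc T₁ T₂ hle t)) ∈ modSet N (solModulus C) I j := by
  have hxc : ContinuousOn x (Icc T₁ T₂) := by
    obtain ⟨-, -, f, -, h⟩ := hx
    exact h.continuousOn
  refine ⟨(hxc.domRestrict.comp continuous_projIcc).continuousOn,
    fun t _ => hx.2.1 (projIcc T₁ T₂ hle t).2, fun s _ t _ => ?_⟩
  refine nndist_le_solModulus hx (projIcc T₁ T₂ hle s).2 (projIcc T₁ T₂ hle t).2 ?_
  rw [← NNReal.coe_le_coe, coe_nndist, coe_nndist, Real.dist_eq, Real.dist_eq]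
  exact abs_projIcc_sub_projIcc hle

/-- The sets `modSet` are closed under pointwise limits; so a limit of solutions belongs to them
even if the limit equation has its right-hand side outside the compact set. -/
theorem mem_modSet_of_tendsto {x : ℕ → ℝ → Eucl N} {x₀ : ℝ → Eucl N}
    (hx : ∀ᶠ n in atTop, x n ∈ modSet N θ I j) (hc : ContinuousOn x₀ (ratIcc I))
    (h : ∀ t ∈ ratIcc I, Tendsto (fun n => x n t) atTop (𝓝 (x₀ t))) : x₀ ∈ modSet N θ I j := by
  refine ⟨hc, fun t ht => ?_, fun s hs t ht => ?_⟩
  · exact Metric.isClosed_closedBall.mem_of_tendsto (h t ht) (hx.mono fun n hn => hn.2.1 ht)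
  · exact le_of_tendsto ((h s hs).nndist (h t ht)) (hx.mono fun n hn => hn.2.2 s hs t ht)

/-- Convergence in `𝒯_Θ` gives convergence of `F n (t, x n t)` in `L¹` along uniformly convergent
curves with moduli of continuity in `Θ`. -/
theorem tendsto_lintegral_comp_of_topTheta (hp1 : 1 ≤ p) {V : Type*} [NormedAddCommGroup V]
    [MeasurableSpace V] [BorelSpace V] [SecondCountableTopology V] {F : ℕ → ThetaC p N θ V}
    {F₀ : ThetaC p N θ V} (hF : Tendsto F atTop (@nhds _ (topTheta p N θ V) F₀))
    {x : ℕ → ℝ → Eucl N} {x₀ : ℝ → Eucl N} (hx : ∀ᶠ n in atTop, x n ∈ modSet N θ I j)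
    (hx₀ : x₀ ∈ modSet N θ I j) (h : TendstoUniformlyOn x x₀ atTop (ratIcc I)) :
    Tendsto (fun n => ∫⁻ t in ratIcc I, ‖(F n : ℝ × Eucl N → V) (t, x n t) -
      (F₀ : ℝ × Eucl N → V) (t, x₀ t)‖ₑ) atTop (𝓝 0) := by
  classical
  have hmeas : ∀ (G : ThetaC p N θ V) (y : ℝ → Eucl N), y ∈ modSet N θ I j →
      AEStronglyMeasurable (fun t => (G : ℝ × Eucl N → V) (t, y t))
        (volume.restrict (ratIcc I)) := fun G y hy =>
    (G.2.1.memLp_comp (a := I.fst) (b := I.snd) hy.1).aestronglyMeasurable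
  -- Membership in `ThetaC` speaks of sequences all of whose terms lie in `modSet`.
  set y : ℕ → ℝ → Eucl N := fun n => if x n ∈ modSet N θ I j then x n else x₀ with hy
  have hxy : ∀ᶠ n in atTop, x n = y n := hx.mono fun n hn => by simp [hy, hn]
  have hym : ∀ n, y n ∈ modSet N θ I j := fun n => by
    by_cases hn : x n ∈ modSet N θ I j <;> simp [hy, hn, hx₀]
  have hyu : TendstoUniformlyOn y x₀ atTop (ratIcc I) :=
    h.congr (hxy.mono fun n hn t _ => by rw [hn])
  have h1 := F₀.2.2 I j y x₀ hym hx₀ hyu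
  have hq : (⨆ x ∈ modSet N θ I j, eLpNorm (fun t => (0 : ℝ × Eucl N → V) (t, x t)) p
      (volume.restrict (ratIcc I))) = 0 :=
    le_antisymm (iSup₂_le fun x _ => le_of_eq eLpNorm_zero') zero_le
  have h2 := tendsto_seminorm_sub (i := (I, j)) hq hF
  have h3 := h2.add h1
  rw [add_zero] at h3
  have h4 : Tendsto (fun n => eLpNorm (fun t => (F n : ℝ × Eucl N → V) (t, y n t) -
      (F₀ : ℝ × Eucl N → V) (t, x₀ t)) p (volume.restrict (ratIcc I))) atTop (𝓝 0) := by
    refine tendsto_of_tendsto_of_tendsto_of_le_of_le tendsto_const_nhds h3 (fun _ => zero_le)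
      fun n => ?_
    have e : (fun t => (F n : ℝ × Eucl N → V) (t, y n t) - (F₀ : ℝ × Eucl N → V) (t, x₀ t)) =
        (fun t => ((F n : ℝ × Eucl N → V) - (F₀ : ℝ × Eucl N → V)) (t, y n t)) +
        fun t => (F₀ : ℝ × Eucl N → V) (t, y n t) - (F₀ : ℝ × Eucl N → V) (t, x₀ t) := by
      ext t
      simp
    simp only [e]
    refine (eLpNorm_add_le ((hmeas (F n) _ (hym n)).sub (hmeas F₀ _ (hym n)))
      ((hmeas F₀ _ (hym n)).sub (hmeas F₀ _ hx₀)) hp1).trans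
      (add_le_add ?_ le_rfl)
    exact le_iSup₂ (f := fun (x : ℝ → Eucl N) (_ : x ∈ modSet N θ I j) =>
      eLpNorm (fun t => ((F n : ℝ × Eucl N → V) - (F₀ : ℝ × Eucl N → V)) (t, x t)) p
        (volume.restrict (ratIcc I))) (y n) (hym n)
  have h5 := tendsto_lintegral_enorm_of_tendsto_eLpNorm hp1
    (fun n => (hmeas (F n) _ (hym n)).sub (hmeas F₀ _ hx₀)) h4
  exact h5.congr' (hxy.mono fun n hn => by simp only [Pi.sub_apply, hn])

end ModSet

/-! ### Linear equations with integrable coefficients -/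

section Linear

variable {V : Type*} [NormedAddCommGroup V] [NormedSpace ℝ V] {T₁ T₂ : ℝ}

theorem integrableOn_clm_apply {A : ℝ → V →L[ℝ] V} (hA : IntegrableOn A (Icc T₁ T₂))
    {y : ℝ → V} (hy : ContinuousOn y (Icc T₁ T₂)) :
    IntegrableOn (fun t => A t (y t)) (Icc T₁ T₂) := by
  obtain ⟨R, hR⟩ := isCompact_Icc.exists_bound_of_continuousOn hy
  refine Integrable.mono' (hA.norm.mul_const R) ?_ ?_
  · exact (ContinuousLinearMap.id ℝ (V →L[ℝ] V)).aestronglyMeasurable_comp₂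
      hA.aestronglyMeasurable (hy.aestronglyMeasurable measurableSet_Icc)
  · filter_upwards [ae_restrict_mem measurableSet_Icc] with t ht
    exact (A t).le_opNorm_of_le (hR t ht)

theorem exists_isSolutionOn_linear [CompleteSpace V] (hT : (0 : ℝ) ∈ Icc T₁ T₂)
    {A : ℝ → V →L[ℝ] V} (hA : IntegrableOn A (Icc T₁ T₂)) {c : ℝ → V}
    (hc : IntegrableOn c (Icc T₁ T₂)) (y₀ : V) :
    ∃ y, IsSolutionOn (fun q : ℝ × V => A q.1 q.2 + c q.1) (Icc T₁ T₂) y ∧ y 0 = y₀ := by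
  refine exists_isSolutionOn_of_lipschitz hT
    (l := (Icc T₁ T₂).indicator fun t => ‖A t‖)
    (integrable_indicator_iff measurableSet_Icc |>.2 hA.norm)
    (fun t => indicator_nonneg (fun _ _ => norm_nonneg _) t)
    (fun w hw => (integrableOn_clm_apply hA hw.continuousOn).add hc) ?_ y₀
  filter_upwards [ae_restrict_mem measurableSet_Icc] with t ht x y
  rw [indicator_of_mem ht, add_sub_add_right_eq_sub, ← map_sub]
  exact (A t).le_opNorm _

/-- Continuous dependence of the solutions of a linear equation on the coefficients in `L¹`. -/
theorem tendstoUniformlyOn_of_isSolutionOn_linear (hT : (0 : ℝ) ∈ Icc T₁ T₂)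
    {A : ℕ → ℝ → V →L[ℝ] V} {A₀ : ℝ → V →L[ℝ] V} {c : ℕ → ℝ → V} {c₀ : ℝ → V}
    {y : ℕ → ℝ → V} {y₀ : ℝ → V} (hA : ∀ᶠ n in atTop, IntegrableOn (A n) (Icc T₁ T₂))
    (hA₀ : IntegrableOn A₀ (Icc T₁ T₂)) (hc : ∀ᶠ n in atTop, IntegrableOn (c n) (Icc T₁ T₂))
    (hc₀ : IntegrableOn c₀ (Icc T₁ T₂))
    (hAA : Tendsto (fun n => ∫⁻ t in Icc T₁ T₂, ‖A n t - A₀ t‖ₑ) atTop (𝓝 0))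
    (hcc : Tendsto (fun n => ∫⁻ t in Icc T₁ T₂, ‖c n t - c₀ t‖ₑ) atTop (𝓝 0))
    (hy : ∀ᶠ n in atTop,
      IsSolutionOn (fun q : ℝ × V => A n q.1 q.2 + c n q.1) (Icc T₁ T₂) (y n))
    (hy₀ : IsSolutionOn (fun q : ℝ × V => A₀ q.1 q.2 + c₀ q.1) (Icc T₁ T₂) y₀)
    (h0 : Tendsto (fun n => y n 0) atTop (𝓝 (y₀ 0))) :
    TendstoUniformlyOn y y₀ atTop (Icc T₁ T₂) := by
  obtain ⟨R, hR⟩ := hy₀.exists_norm_le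
  have hR0 : 0 ≤ R := (norm_nonneg _).trans (hR 0 hT)
  have hAA' := (ENNReal.tendsto_toReal ENNReal.zero_ne_top).comp hAA
  have hcc' := (ENNReal.tendsto_toReal ENNReal.zero_ne_top).comp hcc
  rw [ENNReal.toReal_zero] at hAA' hcc'
  set K : ℝ := (∫ t in Icc T₁ T₂, ‖A₀ t‖) + 1
  have hbound : Tendsto (fun n => 2 * (‖y n 0 - y₀ 0‖ +
      ((∫⁻ t in Icc T₁ T₂, ‖A n t - A₀ t‖ₑ).toReal * R +
        (∫⁻ t in Icc T₁ T₂, ‖c n t - c₀ t‖ₑ).toReal)) * Real.exp (4 * K)) atTop (𝓝 0) := by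
    have h2 := ((tendsto_iff_norm_sub_tendsto_zero.1 h0).add
      ((hAA'.mul_const R).add hcc')).const_mul 2
    simpa using h2.mul_const (Real.exp (4 * K))
  rw [Metric.tendstoUniformlyOn_iff]
  intro ε hε
  filter_upwards [hbound.eventually_lt_const hε, hAA'.eventually_lt_const one_pos, hA, hc, hy]
    with n hn hn1 hAn hcn hyn t ht
  have hdA : IntegrableOn (fun t => A n t - A₀ t) (Icc T₁ T₂) := hAn.sub hA₀
  have hdc : IntegrableOn (fun t => c n t - c₀ t) (Icc T₁ T₂) := hcn.sub hc₀
  have eA : ∫ t in Icc T₁ T₂, ‖A n t - A₀ t‖ = (∫⁻ t in Icc T₁ T₂, ‖A n t - A₀ t‖ₑ).toReal :=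
    integral_norm_eq_lintegral_enorm hdA.aestronglyMeasurable
  have ec : ∫ t in Icc T₁ T₂, ‖c n t - c₀ t‖ = (∫⁻ t in Icc T₁ T₂, ‖c n t - c₀ t‖ₑ).toReal :=
    integral_norm_eq_lintegral_enorm hdc.aestronglyMeasurable
  have hK : ∫ t, (Icc T₁ T₂).indicator (fun t => ‖A n t‖) t ≤ K := by
    rw [integral_indicator measurableSet_Icc]
    calc ∫ t in Icc T₁ T₂, ‖A n t‖ ≤ ∫ t in Icc T₁ T₂, (‖A₀ t‖ + ‖A n t - A₀ t‖) := by
          refine integral_mono hAn.norm (hA₀.norm.add hdA.norm) fun t => ?_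
          have := norm_add_le (A₀ t) (A n t - A₀ t)
          rwa [add_sub_cancel] at this
      _ = (∫ t in Icc T₁ T₂, ‖A₀ t‖) + ∫ t in Icc T₁ T₂, ‖A n t - A₀ t‖ :=
          integral_add hA₀.norm hdA.norm
      _ ≤ K := by
          rw [eA]
          exact add_le_add le_rfl hn1.le
  have key := hyn.norm_sub_le (k := fun t => ‖A n t - A₀ t‖ * R + ‖c n t - c₀ t‖) hT hy₀
    (integrable_indicator_iff measurableSet_Icc |>.2 hAn.norm)
    (fun t => indicator_nonneg (fun _ _ => norm_nonneg _) t)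
    ((hdA.norm.mul_const R).add hdc.norm) (fun t => by positivity) (by
      filter_upwards [ae_restrict_mem measurableSet_Icc] with s hs
      rw [indicator_of_mem hs]
      have e : A n s (y n s) + c n s - (A₀ s (y₀ s) + c₀ s) =
          A n s (y n s - y₀ s) + ((A n s - A₀ s) (y₀ s) + (c n s - c₀ s)) := by
        simp only [map_sub, sub_apply]
        abel
      rw [e]
      refine (norm_add_le _ _).trans (add_le_add ((A n s).le_opNorm _)
        ((norm_add_le _ _).trans (add_le_add ?_ le_rfl)))
      exact (A n s - A₀ s).le_opNorm_of_le (hR s hs)) t ht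
  rw [integral_add (hdA.norm.mul_const R) hdc.norm, integral_mul_const, eA, ec] at key
  rw [dist_comm, dist_eq_norm]
  refine (key.trans ?_).trans_lt hn
  gcongr

end Linear

/-! ### The triangular system -/

section Triangular

theorem isSolutionOn_triangular_iff {f : ℝ × Eucl N → Eucl N}
    {F : ℝ × Eucl N → (Eucl N →L[ℝ] Eucl N)} {h : ℝ × Eucl N → Eucl N} {J : Set ℝ}
    {w : ℝ → Eucl N × Eucl N} :
    IsSolutionOn (triangular f F h) J w ↔ IsSolutionOn f J (fun t => (w t).1) ∧
      IsSolutionOn (fun q : ℝ × Eucl N => F (q.1, (w q.1).1) q.2 + h (q.1, (w q.1).1)) J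
        (fun t => (w t).2) := by
  constructor
  · refine fun hw => ⟨⟨hw.1, fun s hs t ht => ?_⟩, ⟨hw.1, fun s hs t ht => ?_⟩⟩
    · obtain ⟨hi, e⟩ := hw.2 s hs t ht
      refine ⟨⟨hi.1.fst, hi.2.fst⟩, ?_⟩
      have := (ContinuousLinearMap.fst ℝ (Eucl N) (Eucl N)).intervalIntegral_comp_comm hi
      exact (congrArg Prod.fst e).trans (congrArg ((w s).1 + ·) this.symm)
    · obtain ⟨hi, e⟩ := hw.2 s hs t ht
      refine ⟨⟨hi.1.snd, hi.2.snd⟩, ?_⟩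
      have := (ContinuousLinearMap.snd ℝ (Eucl N) (Eucl N)).intervalIntegral_comp_comm hi
      exact (congrArg Prod.snd e).trans (congrArg ((w s).2 + ·) this.symm)
  · rintro ⟨h1, h2⟩
    refine ⟨h1.1, fun s hs t ht => ?_⟩
    obtain ⟨hi1, e1⟩ := h1.2 s hs t ht
    obtain ⟨hi2, e2⟩ := h2.2 s hs t ht
    have hi : IntervalIntegrable (fun u => triangular f F h (u, w u)) volume s t :=
      ⟨hi1.1.prodMk hi2.1, hi1.2.prodMk hi2.2⟩
    refine ⟨hi, Prod.ext ?_ ?_⟩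
    · have := (ContinuousLinearMap.fst ℝ (Eucl N) (Eucl N)).intervalIntegral_comp_comm hi
      exact e1.trans (congrArg ((w s).1 + ·) this)
    · have := (ContinuousLinearMap.snd ℝ (Eucl N) (Eucl N)).intervalIntegral_comp_comm hi
      exact e2.trans (congrArg ((w s).2 + ·) this)

/-- As the second equation is linear, solutions of the triangular system exist wherever those of
the first equation do. -/
theorem subset_maxInterval_triangular (hp1 : 1 ≤ p) {f : ℝ × Eucl N → Eucl N}
    {F : ℝ × Eucl N → (Eucl N →L[ℝ] Eucl N)} {h : ℝ × Eucl N → Eucl N} (hF : IsCarath p F)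
    (hh : IsCarath p h) {T₁ T₂ : ℝ} (hT : (0 : ℝ) ∈ Icc T₁ T₂) {x : ℝ → Eucl N}
    (hx : IsSolutionOn f (Icc T₁ T₂) x) (y₀ : Eucl N) :
    Icc T₁ T₂ ⊆ maxInterval (triangular f F h) (x 0, y₀) := by
  obtain ⟨y, hy, hy0⟩ := exists_isSolutionOn_linear hT
    (hF.integrableOn_comp hp1 hx.continuousOn) (hh.integrableOn_comp hp1 hx.continuousOn) y₀
  exact IsSolutionOn.subset_maxInterval (w := fun t => (x t, y t))
    (isSolutionOn_triangular_iff.2 ⟨hx, hy⟩) hT (by rw [hy0])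

/-- Continuous dependence for the triangular system on a compact interval containing the initial
time. The first components converge uniformly and are curves of the sets `modSet`, so that the
coefficients of the linear equations for the second components converge in `L¹`. -/
theorem tendstoUniformlyOn_of_isSolutionOn_triangular (hp1 : 1 ≤ p) {D : Set (Eucl N)}
    (hD : Dense D) {E C : Set (LC p N)} (hE : HasLpLocBoundedLBounds E) (hCE : C ⊆ E)
    {f : ℕ → LC p N} {f₀ : LC p N}
    {F : ℕ → ThetaC p N (solModulus C) (Eucl N →L[ℝ] Eucl N)}
    {F₀ : ThetaC p N (solModulus C) (Eucl N →L[ℝ] Eucl N)}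
    {h : ℕ → ThetaC p N (solModulus C) (Eucl N)} {h₀ : ThetaC p N (solModulus C) (Eucl N)}
    {T₁ T₂ : ℝ} {w : ℕ → ℝ → Eucl N × Eucl N} {w₀ : ℝ → Eucl N × Eucl N}
    (hfC : ∀ n, f n ∈ C) (hf : Tendsto f atTop (@nhds _ (topD p D) f₀))
    (hF : Tendsto F atTop (@nhds _ (topTheta p N (solModulus C) (Eucl N →L[ℝ] Eucl N)) F₀))
    (hh : Tendsto h atTop (@nhds _ (topTheta p N (solModulus C) (Eucl N)) h₀))
    (h0 : Tendsto (fun n => w n 0) atTop (𝓝 (w₀ 0))) (hT : (0 : ℝ) ∈ Icc T₁ T₂)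
    (hw : ∀ᶠ n in atTop, IsSolutionOn (triangular (f n) (F n) (h n)) (Icc T₁ T₂) (w n))
    (hw₀ : IsSolutionOn (triangular f₀ F₀ h₀) (Icc T₁ T₂) w₀) :
    TendstoUniformlyOn w w₀ atTop (Icc T₁ T₂) := by
  have hle : T₁ ≤ T₂ := hT.1.trans hT.2
  obtain ⟨hx₀, hy₀⟩ := isSolutionOn_triangular_iff.1 hw₀
  have hx := hw.mono fun n hn => (isSolutionOn_triangular_iff.1 hn).1
  have hy := hw.mono fun n hn => (isSolutionOn_triangular_iff.1 hn).2
  have hxu : TendstoUniformlyOn (fun n t => (w n t).1) (fun t => (w₀ t).1) atTop (Icc T₁ T₂) :=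
    tendstoUniformlyOn_of_isSolutionOn hp1 hD hE (fun n => hCE (hfC n)) hf h0.fst_nhds hT hx₀ hx
  obtain ⟨I, hI⟩ := exists_subset_ratIcc T₁ T₂
  obtain ⟨R, hR⟩ := hx₀.exists_norm_le
  obtain ⟨j, hj⟩ := exists_nat_ge (R + 1)
  set π : ℝ → ℝ := fun t => projIcc T₁ T₂ hle t with hπ
  have hπI : ∀ t, π t ∈ Icc T₁ T₂ := fun t => (projIcc T₁ T₂ hle t).2
  have hπid : ∀ t ∈ Icc T₁ T₂, π t = t := fun t ht => by simp [hπ, projIcc_of_mem hle ht]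
  have hmod : ∀ᶠ n in atTop, (fun t => (w n (π t)).1) ∈ modSet N (solModulus C) I j := by
    filter_upwards [hx, Metric.tendstoUniformlyOn_iff.1 hxu 1 one_pos] with n hn hn1
    refine comp_projIcc_mem_modSet (x := fun t => (w n t).1) hle
      ⟨hI, fun t ht => mem_closedBall_zero_iff.2 ?_, f n, hfC n, hn⟩
    have h1 := hn1 t ht
    rw [dist_comm, dist_eq_norm] at h1
    have h2 := norm_add_le ((w n t).1 - (w₀ t).1) (w₀ t).1
    rw [sub_add_cancel] at h2
    linarith [hR t ht]
  have hπu : TendstoUniformlyOn (fun n t => (w n (π t)).1) (fun t => (w₀ (π t)).1) atTop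
      (ratIcc I) := (hxu.comp π).mono fun t _ => hπI t
  have hmod₀ : (fun t => (w₀ (π t)).1) ∈ modSet N (solModulus C) I j :=
    mem_modSet_of_tendsto hmod
      ((hx₀.continuousOn.domRestrict.comp (continuous_projIcc (h := hle))).continuousOn)
      fun t ht => hπu.tendsto_at ht
  have hrestr : ∀ {V : Type} [NormedAddCommGroup V] {G : ℕ → ℝ × Eucl N → V}
      {G₀ : ℝ × Eucl N → V}, Tendsto (fun n => ∫⁻ t in ratIcc I, ‖G n (t, (w n (π t)).1) -
        G₀ (t, (w₀ (π t)).1)‖ₑ) atTop (𝓝 0) →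
      Tendsto (fun n => ∫⁻ t in Icc T₁ T₂, ‖G n (t, (w n t).1) - G₀ (t, (w₀ t).1)‖ₑ) atTop
        (𝓝 0) := fun {V} _ {G G₀} hG => by
    refine tendsto_of_tendsto_of_tendsto_of_le_of_le tendsto_const_nhds hG (fun _ => zero_le)
      fun n => ?_
    refine le_trans (le_of_eq ?_) (lintegral_mono_set hI)
    exact setLIntegral_congr_fun measurableSet_Icc fun t ht => by simp only [hπid t ht]
  have hyu : TendstoUniformlyOn (fun n t => (w n t).2) (fun t => (w₀ t).2) atTop (Icc T₁ T₂) :=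
    tendstoUniformlyOn_of_isSolutionOn_linear hT
      (hx.mono fun n hn => (F n).2.1.integrableOn_comp hp1 hn.continuousOn)
      (F₀.2.1.integrableOn_comp hp1 hx₀.continuousOn)
      (hx.mono fun n hn => (h n).2.1.integrableOn_comp hp1 hn.continuousOn)
      (h₀.2.1.integrableOn_comp hp1 hx₀.continuousOn)
      (hrestr (tendsto_lintegral_comp_of_topTheta hp1 hF hmod hmod₀ hπu))
      (hrestr (tendsto_lintegral_comp_of_topTheta hp1 hh hmod hmod₀ hπu))
      hy hy₀ h0.snd_nhds
  rw [Metric.tendstoUniformlyOn_iff] at hxu hyu ⊢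
  intro ε hε
  filter_upwards [hxu ε hε, hyu ε hε] with n h1 h2 t ht
  exact max_lt (h1 t ht) (h2 t ht)

end Triangular

end Caratheodory

open Caratheodory
theorem mainTheorem6 (N : ℕ) (p : ℝ≥0∞) (hp1 : 1 ≤ p) (hp : p ≠ ∞)
    (D : Set (Eucl N)) (hDc : D.Countable) (hD : Dense D)
    (E : Set (LC p N)) (hE : HasLpLocBoundedLBounds E) :
    -- (i) continuous dependence of the solutions of `ẋ = f(t, x)`, `x(0) = x₀`
    (∀ (f : ℕ → LC p N) (f₀ : LC p N) (a : ℕ → Eucl N) (a₀ : Eucl N)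
        (x : ℕ → ℝ → Eucl N) (x₀ : ℝ → Eucl N),
      (∀ n, f n ∈ E) →
      Tendsto f atTop (@nhds _ (topD p D) f₀) →
      Tendsto a atTop (𝓝 a₀) →
      (∀ n, IsMaxSolution (f n : ℝ × Eucl N → Eucl N) (a n) (x n)) →
      IsMaxSolution (f₀ : ℝ × Eucl N → Eucl N) a₀ x₀ →
      ∀ T₁ T₂ : ℝ, Icc T₁ T₂ ⊆ maxInterval (f₀ : ℝ × Eucl N → Eucl N) a₀ →
        (∀ᶠ n in atTop, Icc T₁ T₂ ⊆ maxInterval (f n : ℝ × Eucl N → Eucl N) (a n)) ∧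
        TendstoUniformlyOn x x₀ atTop (Icc T₁ T₂)) ∧
    -- (ii) equicontinuity of the sets of solutions, and the suitable set of moduli
    (∀ C : Set (LC p N), C ⊆ E → @IsCompact _ (topD p D) C →
      (∀ (I : NonemptyInterval ℚ) (j : ℕ), ∀ ε > 0, ∃ δ > 0, ∀ z ∈ solSet C I j,
        ∀ s ∈ z.1, ∀ t ∈ z.1, dist s t < δ → dist (z.2 s) (z.2 t) < ε) ∧
      (∀ (I : NonemptyInterval ℚ) (j : ℕ), ∀ z ∈ solSet C I j,
        ∀ s ∈ z.1, ∀ t ∈ z.1, nndist (z.2 s) (z.2 t) ≤ solModulus C I j (nndist s t)) ∧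
      IsSuitable (solModulus C)) ∧
    -- (iii) continuous dependence of the solutions of the triangular system
    (∀ C : Set (LC p N), C ⊆ E → @IsCompact _ (topD p D) C →
      ∀ (f : ℕ → LC p N) (f₀ : LC p N)
        (F : ℕ → ThetaC p N (solModulus C) (Eucl N →L[ℝ] Eucl N))
        (F₀ : ThetaC p N (solModulus C) (Eucl N →L[ℝ] Eucl N))
        (h : ℕ → ThetaC p N (solModulus C) (Eucl N)) (h₀ : ThetaC p N (solModulus C) (Eucl N))
        (a b : ℕ → Eucl N) (a₀ b₀ : Eucl N)
        (w : ℕ → ℝ → Eucl N × Eucl N) (w₀ : ℝ → Eucl N × Eucl N),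
      (∀ n, f n ∈ C) →
      Tendsto f atTop (@nhds _ (topD p D) f₀) →
      Tendsto F atTop (@nhds _ (topTheta p N (solModulus C) (Eucl N →L[ℝ] Eucl N)) F₀) →
      Tendsto h atTop (@nhds _ (topTheta p N (solModulus C) (Eucl N)) h₀) →
      Tendsto a atTop (𝓝 a₀) →
      Tendsto b atTop (𝓝 b₀) →
      (∀ n, IsMaxSolution (triangular (f n) (F n) (h n)) (a n, b n) (w n)) →
      IsMaxSolution (triangular f₀ F₀ h₀) (a₀, b₀) w₀ →
      ∀ T₁ T₂ : ℝ, Icc T₁ T₂ ⊆ maxInterval (f₀ : ℝ × Eucl N → Eucl N) a₀ →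
        Icc T₁ T₂ ⊆ maxInterval (triangular f₀ F₀ h₀) (a₀, b₀) ∧
        (∀ᶠ n in atTop, Icc T₁ T₂ ⊆ maxInterval (triangular (f n) (F n) (h n)) (a n, b n)) ∧
        TendstoUniformlyOn w w₀ atTop (Icc T₁ T₂)) := by
  have equicont := fun (C : Set (LC p N)) (hCE : C ⊆ E) (hC : @IsCompact _ (topD p D) C)
      (I : NonemptyInterval ℚ) (j : ℕ) (ε : ℝ) (hε : ε > 0) =>
    exists_dist_lt_of_mem_solSet hp1 hD hE hCE hC I j hε
  refine ⟨?_, fun C hCE hC => ⟨equicont C hCE hC, fun I j z hz s hs t ht =>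
    nndist_le_solModulus hz hs ht le_rfl, isSuitable_solModulus (equicont C hCE hC)⟩, ?_⟩
  · intro f f₀ a a₀ x x₀ hfE hf ha hx hx₀ T₁ T₂ hTT
    rcases lt_or_ge T₂ T₁ with hlt | hle
    · simp [Icc_eq_empty hlt.not_ge, tendstoUniformlyOn_empty]
    -- The interval need not contain the initial time, and is enlarged so as to contain it.
    have hsub : Icc T₁ T₂ ⊆ Icc (min T₁ 0) (max T₂ 0) :=
      Icc_subset_Icc (min_le_left _ _) (le_max_left _ _)
    have hT : (0 : ℝ) ∈ Icc (min T₁ 0) (max T₂ 0) := ⟨min_le_right _ _, le_max_right _ _⟩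
    have hsol₀ := hx₀.isSolutionOn (Icc_min_max_subset_maxInterval hle hTT)
    have ha' : Tendsto a atTop (𝓝 (x₀ 0)) := by rwa [hx₀.2]
    have hmax : ∀ᶠ n in atTop, Icc (min T₁ 0) (max T₂ 0) ⊆
        maxInterval (f n : ℝ × Eucl N → Eucl N) (a n) :=
      (eventually_exists_isSolutionOn hp1 hD hE hfE hf ha' hT hsol₀ one_pos).mono
        fun n ⟨y, hy, hy0, _⟩ => hy.subset_maxInterval hT hy0
    refine ⟨hmax.mono fun n hn => hsub.trans hn, TendstoUniformlyOn.mono ?_ hsub⟩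
    exact tendstoUniformlyOn_of_isSolutionOn hp1 hD hE hfE hf (by simpa only [(hx _).2] using ha')
      hT hsol₀ (hmax.mono fun n hn => (hx n).isSolutionOn hn)
  · intro C hCE hC f f₀ F F₀ h h₀ a b a₀ b₀ w w₀ hfC hf hF hh ha hb hw hw₀ T₁ T₂ hTT
    rcases lt_or_ge T₂ T₁ with hlt | hle
    · simp [Icc_eq_empty hlt.not_ge, tendstoUniformlyOn_empty]
    have hsub : Icc T₁ T₂ ⊆ Icc (min T₁ 0) (max T₂ 0) :=
      Icc_subset_Icc (min_le_left _ _) (le_max_left _ _)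
    have hT : (0 : ℝ) ∈ Icc (min T₁ 0) (max T₂ 0) := ⟨min_le_right _ _, le_max_right _ _⟩
    obtain ⟨x₀, hx₀, rfl⟩ := exists_isSolutionOn_of_Icc_subset_maxInterval hT
      (Icc_min_max_subset_maxInterval hle hTT)
    have hmax₀ := subset_maxInterval_triangular hp1 F₀.2.1 h₀.2.1 hT hx₀ b₀
    have hmax : ∀ᶠ n in atTop, Icc (min T₁ 0) (max T₂ 0) ⊆
        maxInterval (triangular (f n) (F n) (h n)) (a n, b n) :=
      (eventually_exists_isSolutionOn hp1 hD hE (fun n => hCE (hfC n)) hf ha hT hx₀ one_pos).mono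
        fun n ⟨y, hy, hy0, _⟩ => by
          rw [← hy0]
          exact subset_maxInterval_triangular hp1 (F n).2.1 (h n).2.1 hT hy (b n)
    refine ⟨hsub.trans hmax₀, hmax.mono fun n hn => hsub.trans hn,
      TendstoUniformlyOn.mono ?_ hsub⟩
    refine tendstoUniformlyOn_of_isSolutionOn_triangular hp1 hD hE hCE hfC hf hF hh ?_ hT
      (hmax.mono fun n hn => (hw n).isSolutionOn hn) (hw₀.isSolutionOn hmax₀)
    simp only [(hw _).2, hw₀.2]
    exact ha.prodMk_nhds hb
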